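/- Let $N\ge 1$, $s\in(0,1)$, let $\Omega\subset\mathbb R^N$ be an open set and $c\in L^\infty(\Omega)$. Let $H^s(\mathbb R^N)$ be the space of all $u\in L^2(\mathbb R^N)$ with $$[u]^2:=\int_{\mathbb R^N}\int_{\mathbb R^N}\frac{|u(x)-u(y)|^2}{|x-y|^{N+2s}}\,dx\,dy<+\infty ,$$ and let $H^s_0(\Omega)$ be the closure of $C_c^\infty(\Omega)$ in $H^s(\mathbb R^N)$ with respect to the norm $(\|u\|_{L^2}^2+[u]^2)^{1/2}$. Let $u\in H^s_0(\Omega)\cap C(\mathbb R^N)$ satisfy $u=0$ in $\mathbb R^N\setminus\Omega$ and $(-\Delta)^s u\ge c(x)u$ in $\Omega$ in the weak sense, that is, $$\int_{\mathbb R^N}\int_{\mathbb R^N}\frac{(u(x)-u(y))(\varphi(x)-\varphi(y))}{|x-y|^{N+2s}}\,dx\,dy\ \ge\ \int_\Omega c(x)u(x)\varphi(x)\,dx$$ for every $\varphi\in H^s_0(\Omega)$ with $\varphi\ge 0$ a.e. in $\Omega$. Suppose that $u^-=\max\{-u,0\}\in L^\infty(\Omega)$. Let $x_0\in\partial\Omega$,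 and suppose that $\Omega$ satisfies an interior ball condition at $x_0$: there is a ball $B_R(y_0)\subset\Omega$, $R>0$, with $x_0\in\partial B_R(y_0)$. Suppose moreover that there is $\delta>0$ such that $u\ge 0$ in $B_\delta(x_0)\cap\Omega$. For $\beta\in(0,\frac{\pi}{2})$ set $$C_\beta(x_0):=\left\{x\in\Omega\ \middle|\ \arccos\left(\frac{x-x_0}{|x-x_0|}\cdot\frac{y_0-x_0}{|y_0-x_0|}\right)<\beta\right\}.$$ For every sufficiently small $r>0$ let $z_r\in\Omega$ be such that $B_r(z_r)\subset\Omega$ and $x_0\in\partial B_r(z_r)$. Then the following two conditions are equivalent (upper and lower limits being taken in $[-\infty,+\infty]$): (i) $\displaystyle \limsup_{r\to0^+}\left(\frac{1}{r^{2s}}\inf_{B_{r/2}(z_r)}|u|\right)>0.$ (ii) $u$ satisfies Hopf's Lemma at $x_0$, that is, for every $\beta\in(0,\frac{\pi}{2})$, $$\liminf_{\substack{x\to x_0\\ x\in C_\beta(x_0)}}\frac{u(x)}{|x-x_0|^s}>0 .$$ -/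

import Mathlib

open MeasureTheory Filter Topology Metric Set
open scoped ENNReal ContDiff

noncomputable section

namespace FracHopf

/-- The square `[u]²` of the Gagliardo seminorm of order `s` on `ℝᴺ`, with values in `[0, ∞]`. -/
def gagliardoSq {N : ℕ} (s : ℝ) (u : EuclideanSpace ℝ (Fin N) → ℝ) : ℝ≥0∞ :=
  ∫⁻ p : EuclideanSpace ℝ (Fin N) × EuclideanSpace ℝ (Fin N),
    ENNReal.ofReal ((u p.1 - u p.2) ^ 2 / ‖p.1 - p.2‖ ^ ((N : ℝ) + 2 * s))

/-- Membership in the fractional Sobolev space `Hˢ(ℝᴺ)`. -/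
def MemHs {N : ℕ} (s : ℝ) (u : EuclideanSpace ℝ (Fin N) → ℝ) : Prop :=
  MemLp u 2 volume ∧ gagliardoSq s u < ⊤

/-- `φ ∈ C_c^∞(Ω)`. -/
def IsTestFunction {N : ℕ} (Ω : Set (EuclideanSpace ℝ (Fin N)))
    (φ : EuclideanSpace ℝ (Fin N) → ℝ) : Prop :=
  ContDiff ℝ ∞ φ ∧ HasCompactSupport φ ∧ tsupport φ ⊆ Ω

/-- Membership in `Hˢ₀(Ω)`, the closure of `C_c^∞(Ω)` in `Hˢ(ℝᴺ)`. -/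
def MemHs0 {N : ℕ} (s : ℝ) (Ω : Set (EuclideanSpace ℝ (Fin N)))
    (u : EuclideanSpace ℝ (Fin N) → ℝ) : Prop :=
  MemHs s u ∧
    ∃ φ : ℕ → EuclideanSpace ℝ (Fin N) → ℝ,
      (∀ n, IsTestFunction Ω (φ n)) ∧
      Tendsto (fun n => eLpNorm (fun x => u x - φ n x) 2 volume) atTop (𝓝 0) ∧
      Tendsto (fun n => gagliardoSq s (fun x => u x - φ n x)) atTop (𝓝 0)

/-- The bilinear form
`∬ (u(x) - u(y)) (φ(x) - φ(y)) / |x - y|^(N + 2s) dx dy` of the fractional Laplacian. The integrand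
is absolutely integrable whenever `u` and `φ` belong to `Hˢ(ℝᴺ)`. -/
def energyForm {N : ℕ} (s : ℝ) (u φ : EuclideanSpace ℝ (Fin N) → ℝ) : ℝ :=
  ∫ p : EuclideanSpace ℝ (Fin N) × EuclideanSpace ℝ (Fin N),
    (u p.1 - u p.2) * (φ p.1 - φ p.2) / ‖p.1 - p.2‖ ^ ((N : ℝ) + 2 * s)

/-- `u ∈ Hˢ₀(Ω)` satisfies `(-Δ)ˢ u ≥ c u` weakly in `Ω` and `u = 0` in `ℝᴺ \ Ω`. -/
def IsSupersolution {N : ℕ} (s : ℝ) (Ω : Set (EuclideanSpace ℝ (Fin N)))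
    (c u : EuclideanSpace ℝ (Fin N) → ℝ) : Prop :=
  MemHs0 s Ω u ∧ (∀ x, x ∉ Ω → u x = 0) ∧
    ∀ φ : EuclideanSpace ℝ (Fin N) → ℝ, MemHs0 s Ω φ →
      (∀ᵐ x ∂(volume.restrict Ω), 0 ≤ φ x) →
      ∫ x in Ω, c x * u x * φ x ≤ energyForm s u φ

/-- The cone `C_β(x₀)` of half-opening `β` in `Ω` with vertex `x₀` and axis `y₀ - x₀`. Here
`angle v w = arccos (v ⬝ w / (|v| |w|))`. -/
def cone {N : ℕ} (Ω : Set (EuclideanSpace ℝ (Fin N))) (x₀ y₀ : EuclideanSpace ℝ (Fin N))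
    (β : ℝ) : Set (EuclideanSpace ℝ (Fin N)) :=
  {x | x ∈ Ω ∧ InnerProductGeometry.angle (x - x₀) (y₀ - x₀) < β}

/-- `u` satisfies Hopf's Lemma at `x₀`, with respect to cones around an interior ball centred
at `y₀`. The lower limit is taken in `[-∞, ∞]`. -/
def SatisfiesHopf {N : ℕ} (s : ℝ) (Ω : Set (EuclideanSpace ℝ (Fin N)))
    (x₀ y₀ : EuclideanSpace ℝ (Fin N)) (u : EuclideanSpace ℝ (Fin N) → ℝ) : Prop :=
  ∀ β : ℝ, 0 < β → β < Real.pi / 2 →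
    (0 : EReal) <
      liminf (fun x => ((u x / ‖x - x₀‖ ^ s : ℝ) : EReal)) (𝓝[cone Ω x₀ y₀ β] x₀)

/-- The condition `limsup_{r → 0⁺} r^(-2s) inf_{B_{r/2}(z_r)} |u| > 0`. The upper limit is taken in
`[-∞, ∞]`. -/
def FastGrowth {N : ℕ} (s : ℝ) (z : ℝ → EuclideanSpace ℝ (Fin N))
    (u : EuclideanSpace ℝ (Fin N) → ℝ) : Prop :=
  (0 : EReal) <
    limsup (fun r : ℝ =>
      ((1 / r ^ (2 * s) * sInf ((fun x => |u x|) '' ball (z r) (r / 2)) : ℝ) : EReal)) (𝓝[>] 0)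

end FracHopf

end

/-!
The two conditions are compared through the *interaction* of `u` with the boundary point,
`∫ u(x) |x - x₀|^(-N-2s) dx` over a ball around `x₀`; each of them is equivalent to its divergence.

Either condition provides, at arbitrarily small scales `r`, a ball of radius `r / 4` within distance
`2 r` of `x₀` on which `u ≥ κ r^(2s)`. Such a ball contributes to the interaction at least an
amount that does not depend on `r`, so the integral cannot converge (`interaction_eq_top`). Since
the whole mass near `x₀` enters, the directions of the balls play no role.

Conversely, suppose that the interaction is infinite, and let `B_ρ(y) ⊆ Ω` be a small ball touching
`x₀`. Then `u` lies above the barrier `w = (ρ² - |x - y|²)₊ˢ` in that ball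
(`barrier_le_of_infinite_interaction`). The test function is `φ = (w - u⁺)₊`: pairs of points
with one point in the ball and the other in the annulus `τ < |x - x₀| < δ` contribute to the energy
of `w - u` against `φ` an arbitrarily large multiple of `∫ φ` as `τ → 0`. This absorbs the bounded
negative part of `u` away from `x₀`, the zeroth order term and the fractional Laplacian of `w`,
and forces `φ = 0`. The barrier bound gives growth of order `r^(2s)` at half the radius of every
touching ball, and growth of order `|x - x₀|ˢ` in cones.

The fractional Laplacian of `w` is bounded above by a constant that does not depend on `ρ`
(`lintegral_barrier_le`), even when the kernel is truncated to `|x - x'| > ε`. In polar coordinates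
this is a statement on chords: along a line, `w` is the `s`-th power of `h ↦ (W + 2 t h - h²)₊`, and
the truncated operator at `h = 0` is largest if the base point is the midpoint of the chord,
`t = 0`. By the layer cake formula, that reduces to intervals for the measure `dh / h`, where it
holds because the product of the two roots of `κ h² - 2 t h - W` does not depend on `t`
(`two_mul_lintegral_chordProfile_le`). Testing the truncated bound with `w` itself shows that `w`
has finite Gagliardo seminorm.

That `φ` belongs to `Hˢ₀(Ω)` follows by truncation and mollification
(`memHs0_of_continuous`), the seminorm being the `L²` norm of a difference quotient on which the
diagonal translations act continuously.
-/

noncomputable section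

namespace FracHopf

/-! ### The one-dimensional inequality -/

/-- The measure `dh / h` on the half-line `(ε, ∞)`. -/
def logMeasure (ε : ℝ) : Measure ℝ :=
  (volume.restrict (Ioi ε)).withDensity fun h => ENNReal.ofReal h⁻¹

/-- For `b ≤ ε` both sides vanish, the logarithm being nonpositive. -/
lemma logMeasure_Iio {ε b : ℝ} (hε : 0 < ε) (hb : 0 < b) :
    logMeasure ε (Iio b) = ENNReal.ofReal (Real.log (b / ε)) := by
  rw [logMeasure, withDensity_apply _ measurableSet_Iio,
    Measure.restrict_restrict measurableSet_Iio, inter_comm, Ioi_inter_Iio]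
  rcases le_or_gt b ε with h | h
  · rw [Ioo_eq_empty (not_lt.2 h), Measure.restrict_empty, lintegral_zero_measure,
      ENNReal.ofReal_of_nonpos]
    exact Real.log_nonpos (by positivity) ((div_le_one hε).2 h)
  · have hnot : (0 : ℝ) ∉ uIcc ε b := by
      rw [uIcc_of_le h.le]; exact fun h' => absurd h'.1 (not_le.2 hε)
    rw [← integral_inv hnot, intervalIntegral.integral_of_le h.le,
      Measure.restrict_congr_set Ioo_ae_eq_Ioc, ofReal_integral_eq_lintegral_ofReal]
    · exact (intervalIntegral.intervalIntegrable_inv (f := fun x => x)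
        (fun x hx hx0 => hnot (hx0 ▸ hx)) continuousOn_id).1
    · filter_upwards [ae_restrict_mem measurableSet_Ioc] with y hy
      exact inv_nonneg.2 (hε.trans hy.1).le

/-- The positive root of `κ h² - 2 t h - W`. -/
def posRoot (κ W t : ℝ) : ℝ := (t + √(t ^ 2 + κ * W)) / κ

lemma posRoot_pos {κ W : ℝ} (hκ : 0 < κ) (hW : 0 < W) (t : ℝ) : 0 < posRoot κ W t := by
  refine div_pos ?_ hκ
  have h1 : |t| < √(t ^ 2 + κ * W) := by
    rw [← Real.sqrt_sq_eq_abs]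
    exact Real.sqrt_lt_sqrt (sq_nonneg t) (by nlinarith [mul_pos hκ hW])
  linarith [neg_abs_le t]

lemma posRoot_mul_posRoot_neg {κ W : ℝ} (hκ : 0 < κ) (hW : 0 < W) (t : ℝ) :
    posRoot κ W t * posRoot κ W (-t) = W / κ := by
  have h := Real.sq_sqrt (show 0 ≤ t ^ 2 + κ * W by positivity)
  unfold posRoot
  rw [neg_sq]
  field_simp
  nlinarith

lemma lt_posRoot_iff {κ W : ℝ} (hκ : 0 < κ) (hW : 0 < W) (t : ℝ) {h : ℝ} (hh : 0 < h) :
    h < posRoot κ W t ↔ κ * h ^ 2 < W + 2 * t * h := by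
  have h1 := posRoot_pos hκ hW t
  have h2 := posRoot_pos hκ hW (-t)
  have h3 := posRoot_mul_posRoot_neg hκ hW t
  have h4 : posRoot κ W t - posRoot κ W (-t) = 2 * t / κ := by
    unfold posRoot; rw [neg_sq]; ring
  have h5 : W + 2 * t * h - κ * h ^ 2 = κ * ((posRoot κ W t - h) * (posRoot κ W (-t) + h)) := by
    have e1 : W = κ * (posRoot κ W t * posRoot κ W (-t)) := by rw [h3]; field_simp
    have e2 : 2 * t = κ * (posRoot κ W t - posRoot κ W (-t)) := by rw [h4]; field_simp
    rw [e2]; nth_rw 1 [e1]; ring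
  constructor
  · intro h6
    have : 0 < κ * ((posRoot κ W t - h) * (posRoot κ W (-t) + h)) := by
      have := sub_pos.2 h6; positivity
    linarith
  · intro h6
    by_contra h7
    have : (posRoot κ W t - h) * (posRoot κ W (-t) + h) ≤ 0 :=
      mul_nonpos_of_nonpos_of_nonneg (by linarith) (by positivity)
    nlinarith

/-- The profile `((W + 2 t h - h²) / h²)₊`. -/
def chordProfile (W t h : ℝ) : ℝ := max (W * (h⁻¹) ^ 2 + 2 * t * h⁻¹ - 1) 0

lemma logMeasure_chordProfile {ε W τ : ℝ} (hε : 0 < ε) (hW : 0 < W) (hτ : 0 < τ) (t : ℝ) :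
    logMeasure ε {h | τ < chordProfile W t h} =
      ENNReal.ofReal (Real.log (posRoot (1 + τ) W t / ε)) := by
  have hκ : 0 < 1 + τ := by linarith
  rw [← logMeasure_Iio hε (posRoot_pos hκ hW t)]
  apply measure_congr
  have hac : logMeasure ε ≪ volume.restrict (Ioi ε) := withDensity_absolutelyContinuous _ _
  filter_upwards [hac.ae_le (ae_restrict_mem measurableSet_Ioi)] with h hh
  have h0 : 0 < h := hε.trans hh
  apply propext
  change τ < chordProfile W t h ↔ h < _
  rw [lt_posRoot_iff hκ hW t h0, chordProfile, lt_max_iff, or_iff_left (not_lt.2 hτ.le)]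
  have : W * (h⁻¹) ^ 2 + 2 * t * h⁻¹ - 1 - τ = (W + 2 * t * h - (1 + τ) * h ^ 2) / h ^ 2 := by
    field_simp; ring
  rw [← sub_pos, this, div_pos_iff_of_pos_right (by positivity), sub_pos]

/-- The truncated integral of the `s`-th power of the profile along a chord is minimal, after adding
up the two directions, if the base point is the midpoint. The superlevel sets are intervals
`(ε, h₊)` and `(ε, h₋)` with `h₊ h₋` independent of `t`, and `dh / h` turns products into sums. -/
lemma two_mul_lintegral_chordProfile_le {ε W s : ℝ} (hε : 0 < ε) (hW : 0 < W) (hs : 0 < s) (t : ℝ) :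
    2 * ∫⁻ h, ENNReal.ofReal (chordProfile W 0 h ^ s) ∂(logMeasure ε) ≤
      (∫⁻ h, ENNReal.ofReal (chordProfile W t h ^ s) ∂(logMeasure ε)) +
      ∫⁻ h, ENNReal.ofReal (chordProfile W (-t) h ^ s) ∂(logMeasure ε) := by
  have hm : ∀ t, Measurable (chordProfile W t) := fun t => by unfold chordProfile; fun_prop
  have key : ∀ t, ∫⁻ h, ENNReal.ofReal (chordProfile W t h ^ s) ∂(logMeasure ε) =
      ENNReal.ofReal s * ∫⁻ τ in Ioi (0 : ℝ),
        ENNReal.ofReal (Real.log (posRoot (1 + τ) W t / ε)) * ENNReal.ofReal (τ ^ (s - 1)) := by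
    intro t
    rw [lintegral_rpow_eq_lintegral_meas_lt_mul (f := chordProfile W t) _
      (ae_of_all _ fun h => le_max_right _ _) (hm t).aemeasurable hs]
    congr 1
    refine setLIntegral_congr_fun measurableSet_Ioi fun τ hτ => ?_
    rw [logMeasure_chordProfile hε hW hτ]
  have hr : ∀ t, Measurable fun τ : ℝ =>
      ENNReal.ofReal (Real.log (posRoot (1 + τ) W t / ε)) * ENNReal.ofReal (τ ^ (s - 1)) := by
    intro t; unfold posRoot; fun_prop
  rw [key, key, key, ← mul_add, ← lintegral_add_left (hr t), mul_left_comm,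
    ← lintegral_const_mul _ (hr 0)]
  refine mul_le_mul_right (setLIntegral_mono' measurableSet_Ioi fun τ hτ => ?_) _
  rw [← mul_assoc, ← add_mul]
  gcongr
  have hκ : 0 < 1 + τ := by linarith [mem_Ioi.1 hτ]
  have h1 := posRoot_pos hκ hW t
  have h2 := posRoot_pos hκ hW (-t)
  have h0 := posRoot_pos hκ hW 0
  have h3 : posRoot (1 + τ) W t * posRoot (1 + τ) W (-t) =
      posRoot (1 + τ) W 0 * posRoot (1 + τ) W 0 := by
    rw [posRoot_mul_posRoot_neg hκ hW]
    conv_rhs => rw [← neg_zero]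
    nth_rw 1 [neg_zero]
    rw [posRoot_mul_posRoot_neg hκ hW]
  calc 2 * ENNReal.ofReal (Real.log (posRoot (1 + τ) W 0 / ε))
      = ENNReal.ofReal (Real.log (posRoot (1 + τ) W t / ε) +
          Real.log (posRoot (1 + τ) W (-t) / ε)) := by
        rw [← Real.log_mul (by positivity) (by positivity), div_mul_div_comm, h3,
          ← div_mul_div_comm, Real.log_mul (by positivity) (by positivity), ← two_mul,
          ENNReal.ofReal_mul zero_le_two, ENNReal.ofReal_ofNat]
    _ ≤ _ := ENNReal.ofReal_add_le

lemma lintegral_chordProfile {ε W s : ℝ} (hε : 0 < ε) (t : ℝ) :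
    ∫⁻ h, ENNReal.ofReal (chordProfile W t h ^ s) ∂(logMeasure ε) =
      ∫⁻ h in Ioi ε, ENNReal.ofReal (max (W + 2 * t * h - h ^ 2) 0 ^ s * h ^ (-1 - 2 * s)) := by
  rw [logMeasure, lintegral_withDensity_eq_lintegral_mul _ (by fun_prop)
    (by unfold chordProfile; fun_prop)]
  refine setLIntegral_congr_fun measurableSet_Ioi fun h hh => ?_
  have h0 : 0 < h := hε.trans hh
  simp only [Pi.mul_apply]
  rw [← ENNReal.ofReal_mul (by positivity)]
  congr 1
  have e : chordProfile W t h = max (W + 2 * t * h - h ^ 2) 0 * (h ^ 2)⁻¹ := by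
    rw [max_mul_of_nonneg _ _ (by positivity), zero_mul, chordProfile]
    congr 1
    field_simp
  rw [e, Real.mul_rpow (le_max_right _ _) (by positivity), Real.inv_rpow (by positivity),
    ← Real.rpow_natCast, ← Real.rpow_mul h0.le, ← Real.rpow_neg h0.le, mul_left_comm,
    ← Real.rpow_neg_one, ← Real.rpow_add h0]
  congr 2

/-- The constant `1 / (2 - 2s) + 1 / (2s)`, the value of `∫₀^∞ min(h², 1) h^(-1-2s) dh`. -/
def chordConst (s : ℝ) : ℝ := 1 / (2 - 2 * s) + 1 / (2 * s)

/-- A consequence of `(1 - h)₊ˢ ≥ 1 - h`. -/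
lemma sub_rpow_le {W y s : ℝ} (hW : 0 < W) (hy : 0 ≤ y) (hs1 : s < 1) :
    W ^ s - max (W - y) 0 ^ s ≤ W ^ (s - 1) * y := by
  have hW' : W ^ s = W ^ (s - 1) * W := by
    rw [← Real.rpow_add_one hW.ne', sub_add_cancel]
  have h2 : W ^ (s - 1) * (W - y) ≤ max (W - y) 0 ^ s := by
    rcases le_or_gt (W - y) 0 with h | h
    · exact (mul_nonpos_of_nonneg_of_nonpos (by positivity) h).trans
        (Real.rpow_nonneg (le_max_right _ _) _)
    · rw [max_eq_left h.le]
      calc W ^ (s - 1) * (W - y) ≤ (W - y) ^ (s - 1) * (W - y) := by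
            gcongr ?_ * _
            exact Real.rpow_le_rpow_of_nonpos h (by linarith) (by linarith)
        _ = (W - y) ^ s := by rw [← Real.rpow_add_one h.ne', sub_add_cancel]
  rw [hW']; linarith

/-- The bound at the midpoint of the chord: `Wˢ - (W - h²)₊ˢ` is at most `Wˢ min (h² / W) 1`. -/
lemma lintegral_midpoint_le {ε W s : ℝ} (hε : 0 < ε) (hW : 0 < W) (hs0 : 0 < s) (hs1 : s < 1) :
    ∫⁻ h in Ioi ε, ENNReal.ofReal (W ^ s * h ^ (-1 - 2 * s)) ≤
      (∫⁻ h in Ioi ε, ENNReal.ofReal (max (W + 2 * 0 * h - h ^ 2) 0 ^ s * h ^ (-1 - 2 * s))) +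
        ENNReal.ofReal (chordConst s) := by
  have hsq : 0 < √W := Real.sqrt_pos.2 hW
  have hA : ∫⁻ h in Ioc 0 √W, ENNReal.ofReal (W ^ (s - 1) * h ^ (1 - 2 * s)) =
      ENNReal.ofReal (1 / (2 - 2 * s)) := by
    have hi : IntegrableOn (fun h : ℝ => W ^ (s - 1) * h ^ (1 - 2 * s)) (Ioc 0 √W) :=
      ((intervalIntegral.intervalIntegrable_rpow' (by linarith)).1).const_mul _
    rw [← ofReal_integral_eq_lintegral_ofReal hi, ← intervalIntegral.integral_of_le hsq.le,
      intervalIntegral.integral_const_mul, integral_rpow (Or.inl (by linarith)),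
      Real.zero_rpow (by linarith), sub_zero, Real.sqrt_eq_rpow, ← Real.rpow_mul hW.le]
    · congr 1
      rw [← mul_div_assoc, ← Real.rpow_add hW]
      ring_nf
      simp
    · filter_upwards [ae_restrict_mem measurableSet_Ioc] with h hh
      have := hh.1
      positivity
  have hB : ∫⁻ h in Ioi √W, ENNReal.ofReal (W ^ s * h ^ (-1 - 2 * s)) =
      ENNReal.ofReal (1 / (2 * s)) := by
    have hi : IntegrableOn (fun h : ℝ => W ^ s * h ^ (-1 - 2 * s)) (Ioi √W) :=
      (integrableOn_Ioi_rpow_of_lt (by linarith) hsq).const_mul _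
    rw [← ofReal_integral_eq_lintegral_ofReal hi, integral_const_mul,
      integral_Ioi_rpow_of_lt (by linarith) hsq, Real.sqrt_eq_rpow, ← Real.rpow_mul hW.le]
    · congr 1
      rw [mul_div_assoc', mul_neg, ← Real.rpow_add hW,
        show s + 1 / 2 * (-1 - 2 * s + 1) = 0 by ring, Real.rpow_zero,
        show -1 - 2 * s + 1 = -(2 * s) by ring, neg_div_neg_eq]
    · filter_upwards [ae_restrict_mem measurableSet_Ioi] with h hh
      have : 0 < h := hsq.trans hh
      positivity
  have hg : Measurable fun h : ℝ =>
      ENNReal.ofReal (max (W + 2 * 0 * h - h ^ 2) 0 ^ s * h ^ (-1 - 2 * s)) := by fun_prop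
  calc ∫⁻ h in Ioi ε, ENNReal.ofReal (W ^ s * h ^ (-1 - 2 * s))
      ≤ ∫⁻ h in Ioi ε, (ENNReal.ofReal (max (W + 2 * 0 * h - h ^ 2) 0 ^ s * h ^ (-1 - 2 * s)) +
        ((Ioc 0 √W).indicator (fun h => ENNReal.ofReal (W ^ (s - 1) * h ^ (1 - 2 * s))) h +
        (Ioi √W).indicator (fun h => ENNReal.ofReal (W ^ s * h ^ (-1 - 2 * s))) h)) := by
        refine setLIntegral_mono' measurableSet_Ioi fun h hh => ?_
        have h0 : 0 < h := hε.trans hh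
        rcases le_or_gt h √W with h1 | h1
        · rw [indicator_of_mem (show h ∈ Ioc 0 √W from ⟨h0, h1⟩),
            indicator_of_notMem (show h ∉ Ioi √W from not_lt.2 h1), add_zero,
            ← ENNReal.ofReal_add (by positivity) (by positivity)]
          apply ENNReal.ofReal_le_ofReal
          have e : h ^ (1 - 2 * s) = h ^ 2 * h ^ (-1 - 2 * s) := by
            rw [← Real.rpow_natCast, ← Real.rpow_add h0]; congr 1; push_cast; ring
          have := sub_rpow_le hW (sq_nonneg h) hs1
          rw [e, ← mul_assoc, ← add_mul, mul_zero, zero_mul, add_zero]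
          gcongr
          linarith
        · rw [indicator_of_mem (show h ∈ Ioi √W from h1)]
          exact le_add_left (le_add_left le_rfl)
    _ ≤ _ := by
        rw [lintegral_add_left hg]
        gcongr
        refine (setLIntegral_le_lintegral _ _).trans ?_
        rw [lintegral_add_left (Measurable.indicator (by fun_prop) measurableSet_Ioc),
          lintegral_indicator measurableSet_Ioc, lintegral_indicator measurableSet_Ioi, hA, hB,
          chordConst, ENNReal.ofReal_add]
        · exact div_nonneg zero_le_one (by linarith)
        · positivity

/-- On a line, the truncated fractional Laplacian of `h ↦ (W + 2 t h - h²)₊ˢ` at `h = 0` is bounded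
above, uniformly in `W`, in `t` and in the truncation. -/
lemma two_mul_lintegral_chord_le {ε W s : ℝ} (hε : 0 < ε) (hW : 0 < W) (hs0 : 0 < s) (hs1 : s < 1)
    (t : ℝ) :
    2 * ∫⁻ h in Ioi ε, ENNReal.ofReal (W ^ s * h ^ (-1 - 2 * s)) ≤
      (∫⁻ h in Ioi ε, ENNReal.ofReal (max (W + 2 * t * h - h ^ 2) 0 ^ s * h ^ (-1 - 2 * s))) +
      (∫⁻ h in Ioi ε, ENNReal.ofReal (max (W + 2 * -t * h - h ^ 2) 0 ^ s * h ^ (-1 - 2 * s))) +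
        2 * ENNReal.ofReal (chordConst s) := by
  rw [← lintegral_chordProfile hε, ← lintegral_chordProfile hε]
  refine (mul_le_mul_right (lintegral_midpoint_le hε hW hs0 hs1) 2).trans ?_
  rw [mul_add, ← lintegral_chordProfile hε]
  gcongr
  exact two_mul_lintegral_chordProfile_le hε hW hs0 t

/-! ### Polar coordinates and the barrier -/

lemma lintegral_polar {N : ℕ} (hN : 1 ≤ N) {f : EuclideanSpace ℝ (Fin N) → ℝ≥0∞}
    (hf : Measurable f) :
    ∫⁻ x, f x = ∫⁻ θ, (∫⁻ r in Ioi (0 : ℝ), ENNReal.ofReal (r ^ (N - 1)) *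
      f (r • (θ : EuclideanSpace ℝ (Fin N))))
        ∂(volume : Measure (EuclideanSpace ℝ (Fin N))).toSphere := by
  have : Nonempty (Fin N) := ⟨⟨0, hN⟩⟩
  have hmp := Measure.measurePreserving_homeomorphUnitSphereProd
    (volume : Measure (EuclideanSpace ℝ (Fin N)))
  have hfm : Measurable fun p : sphere (0 : EuclideanSpace ℝ (Fin N)) 1 × Ioi (0 : ℝ) =>
      f (p.2.1 • p.1.1) := by fun_prop
  have h1 : ∫⁻ x, f x = ∫⁻ x : ({0}ᶜ : Set (EuclideanSpace ℝ (Fin N))), f x.1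
      ∂(volume.comap Subtype.val) := by
    rw [lintegral_subtype_comap (measurableSet_singleton _).compl, restrict_compl_singleton]
  have h2 := hmp.lintegral_comp hfm
  rw [h1, ← lintegral_congr fun x => ?_, h2, lintegral_prod _ hfm.aemeasurable]
  · refine lintegral_congr fun θ => ?_
    simp only [finrank_euclideanSpace, Fintype.card_fin]
    rw [Measure.volumeIoiPow, lintegral_withDensity_eq_lintegral_mul _ (by fun_prop) (by fun_prop)]
    simp only [Pi.mul_apply]
    exact lintegral_subtype_comap measurableSet_Ioi
      (fun r : ℝ => ENNReal.ofReal (r ^ (N - 1)) * f (r • θ.1))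
  · simp only [homeomorphUnitSphereProd_apply_fst_coe, homeomorphUnitSphereProd_apply_snd_coe]
    rw [smul_inv_smul₀ (norm_ne_zero_iff.2 x.2)]

/-- The kernel `|z|^(-N-2s)` truncated to `|z| > ε`. -/
def truncKernel {N : ℕ} (s ε : ℝ) (z : EuclideanSpace ℝ (Fin N)) : ℝ :=
  {z : EuclideanSpace ℝ (Fin N) | ε < ‖z‖}.indicator (fun z => (‖z‖ ^ ((N : ℝ) + 2 * s))⁻¹) z

lemma truncKernel_nonneg {N : ℕ} (s ε : ℝ) (z : EuclideanSpace ℝ (Fin N)) :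
    0 ≤ truncKernel s ε z := indicator_nonneg (fun _ _ => by positivity) _

lemma measurableSet_lt_norm {N : ℕ} (ε : ℝ) :
    MeasurableSet {z : EuclideanSpace ℝ (Fin N) | ε < ‖z‖} :=
  measurableSet_lt measurable_const measurable_norm

@[fun_prop]
lemma measurable_truncKernel {N : ℕ} (s ε : ℝ) :
    Measurable (truncKernel s ε : EuclideanSpace ℝ (Fin N) → ℝ) := by
  unfold truncKernel
  exact Measurable.indicator (by fun_prop) (measurableSet_lt_norm ε)

lemma truncKernel_neg {N : ℕ} (s ε : ℝ) (z : EuclideanSpace ℝ (Fin N)) :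
    truncKernel s ε (-z) = truncKernel s ε z := by
  simp [truncKernel, indicator]

lemma truncKernel_le {N : ℕ} {s ε : ℝ} (z : EuclideanSpace ℝ (Fin N)) :
    truncKernel s ε z ≤ (‖z‖ ^ ((N : ℝ) + 2 * s))⁻¹ :=
  indicator_le_self' (fun _ _ => by positivity) _

lemma lintegral_mul_truncKernel_polar {N : ℕ} (hN : 1 ≤ N) {s ε : ℝ} (hε : 0 < ε)
    {g : EuclideanSpace ℝ (Fin N) → ℝ} (hg : Measurable g) :
    ∫⁻ z, ENNReal.ofReal (g z * truncKernel s ε z) =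
      ∫⁻ θ, (∫⁻ r in Ioi ε, ENNReal.ofReal (g (r • (θ : EuclideanSpace ℝ (Fin N))) *
        r ^ (-1 - 2 * s))) ∂(volume : Measure (EuclideanSpace ℝ (Fin N))).toSphere := by
  rw [lintegral_polar hN (by fun_prop)]
  refine lintegral_congr fun θ => ?_
  have hθ : ‖(θ : EuclideanSpace ℝ (Fin N))‖ = 1 := by simp
  rw [← lintegral_indicator measurableSet_Ioi, ← lintegral_indicator measurableSet_Ioi]
  refine lintegral_congr fun r => ?_
  by_cases hr : ε < r
  · have h0 : 0 < r := hε.trans hr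
    have hn : ‖r • (θ : EuclideanSpace ℝ (Fin N))‖ = r := by
      rw [norm_smul, hθ, mul_one, Real.norm_of_nonneg h0.le]
    rw [indicator_of_mem (show r ∈ Ioi 0 from h0), indicator_of_mem (show r ∈ Ioi ε from hr),
      ← ENNReal.ofReal_mul (by positivity), truncKernel,
      indicator_of_mem (by simpa only [mem_ofPred_eq, hn] using hr),
      hn, mul_left_comm, ← Real.rpow_natCast, ← Real.rpow_neg h0.le, ← Real.rpow_add h0]
    congr 3
    push_cast [Nat.cast_sub hN]
    ring
  · rw [indicator_of_notMem (show r ∉ Ioi ε from hr)]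
    by_cases h0 : 0 < r
    · have hn : ‖r • (θ : EuclideanSpace ℝ (Fin N))‖ = r := by
        rw [norm_smul, hθ, mul_one, Real.norm_of_nonneg h0.le]
      rw [indicator_of_mem (show r ∈ Ioi 0 from h0), truncKernel,
        indicator_of_notMem (by simpa [hn] using hr)]
      simp
    · rw [indicator_of_notMem (show r ∉ Ioi 0 from h0)]

/-- The barrier `(ρ² - |x - y|²)₊ˢ` on the ball `B_ρ(y)`. -/
def barrier {N : ℕ} (s ρ : ℝ) (y x : EuclideanSpace ℝ (Fin N)) : ℝ :=
  max (ρ ^ 2 - ‖x - y‖ ^ 2) 0 ^ s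

/-- A bound for the fractional Laplacian of `barrier s ρ y`, independent of `ρ` and `y`. -/
def barrierConst (N : ℕ) (s : ℝ) : ℝ :=
  chordConst s * (volume : Measure (EuclideanSpace ℝ (Fin N))).toSphere.real univ

lemma barrier_nonneg {N : ℕ} (s ρ : ℝ) (y x : EuclideanSpace ℝ (Fin N)) :
    0 ≤ barrier s ρ y x := Real.rpow_nonneg (le_max_right _ _) _

lemma continuous_barrier {N : ℕ} {s : ℝ} (hs : 0 < s) (ρ : ℝ) (y : EuclideanSpace ℝ (Fin N)) :
    Continuous (barrier s ρ y) := by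
  unfold barrier
  exact Continuous.rpow_const (by fun_prop) fun _ => Or.inr hs.le

lemma barrier_eq_zero {N : ℕ} {s ρ : ℝ} (hs : 0 < s) (hρ : 0 < ρ) {y x : EuclideanSpace ℝ (Fin N)}
    (hx : x ∉ ball y ρ) : barrier s ρ y x = 0 := by
  rw [mem_ball, dist_eq_norm, not_lt] at hx
  rw [barrier, max_eq_right, Real.zero_rpow hs.ne']
  nlinarith

lemma barrier_le {N : ℕ} {s ρ : ℝ} (hs : 0 < s) (y x : EuclideanSpace ℝ (Fin N)) :
    barrier s ρ y x ≤ (ρ ^ 2) ^ s := by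
  unfold barrier
  gcongr
  exact max_le (by nlinarith [sq_nonneg ‖x - y‖]) (sq_nonneg _)

/-- The truncated fractional Laplacian of the barrier is bounded above in the ball. -/
lemma lintegral_barrier_le {N : ℕ} (hN : 1 ≤ N) {s ε ρ : ℝ} (hs0 : 0 < s) (hs1 : s < 1)
    (hε : 0 < ε) {y x : EuclideanSpace ℝ (Fin N)} (hx : x ∈ ball y ρ) :
    ∫⁻ x', ENNReal.ofReal (barrier s ρ y x * truncKernel s ε (x - x')) ≤
      (∫⁻ x', ENNReal.ofReal (barrier s ρ y x' * truncKernel s ε (x - x'))) +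
        ENNReal.ofReal (barrierConst N s) := by
  have hρ : 0 < ρ := pos_of_mem_ball hx
  have hm : Measurable (barrier s ρ y) := (continuous_barrier hs0 ρ y).measurable
  have hW : 0 < ρ ^ 2 - ‖x - y‖ ^ 2 := by
    rw [mem_ball, dist_eq_norm] at hx
    nlinarith [norm_nonneg (x - y)]
  -- The substitutions `x' = x - z` and `x' = x + z` together give the symmetric second difference.
  have hL : ∫⁻ x', ENNReal.ofReal (barrier s ρ y x * truncKernel s ε (x - x')) =
      ∫⁻ z, ENNReal.ofReal (barrier s ρ y x * truncKernel s ε z) :=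
    lintegral_sub_left_eq_self (fun z => ENNReal.ofReal (barrier s ρ y x * truncKernel s ε z)) x
  have hR1 : ∫⁻ x', ENNReal.ofReal (barrier s ρ y x' * truncKernel s ε (x - x')) =
      ∫⁻ z, ENNReal.ofReal (barrier s ρ y (x - z) * truncKernel s ε z) := by
    rw [← lintegral_sub_left_eq_self
      (fun z => ENNReal.ofReal (barrier s ρ y (x - z) * truncKernel s ε z)) x]
    simp
  have hR2 : ∫⁻ x', ENNReal.ofReal (barrier s ρ y x' * truncKernel s ε (x - x')) =
      ∫⁻ z, ENNReal.ofReal (barrier s ρ y (x + z) * truncKernel s ε z) := by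
    rw [← lintegral_add_left_eq_self
      (fun x' => ENNReal.ofReal (barrier s ρ y x' * truncKernel s ε (x - x'))) x]
    simp [truncKernel_neg]
  have hcc : 0 ≤ chordConst s := by
    unfold chordConst
    exact add_nonneg (div_nonneg zero_le_one (by linarith)) (by positivity)
  have key : 2 * ∫⁻ z : EuclideanSpace ℝ (Fin N),
      ENNReal.ofReal (barrier s ρ y x * truncKernel s ε z) ≤
      (∫⁻ z, ENNReal.ofReal (barrier s ρ y (x - z) * truncKernel s ε z)) +
      (∫⁻ z, ENNReal.ofReal (barrier s ρ y (x + z) * truncKernel s ε z)) +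
        2 * ENNReal.ofReal (barrierConst N s) := by
    rw [lintegral_mul_truncKernel_polar hN hε measurable_const,
      lintegral_mul_truncKernel_polar hN hε (g := fun z => barrier s ρ y (x - z)) (by fun_prop),
      lintegral_mul_truncKernel_polar hN hε (g := fun z => barrier s ρ y (x + z)) (by fun_prop),
      barrierConst, ENNReal.ofReal_mul hcc, ofReal_measureReal, ← mul_assoc, ← lintegral_const,
      ← lintegral_const_mul' _ _ (by simp)]
    have hmeas : Measurable fun θ : sphere (0 : EuclideanSpace ℝ (Fin N)) 1 =>
        ∫⁻ r in Ioi ε, ENNReal.ofReal (barrier s ρ y (x - r • θ.1) * r ^ (-1 - 2 * s)) := by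
      refine Measurable.lintegral_prod_right' (f := fun p : sphere (0 : EuclideanSpace ℝ (Fin N)) 1
          × ℝ => ENNReal.ofReal (barrier s ρ y (x - p.2 • p.1.1) * p.2 ^ (-1 - 2 * s))) ?_
      fun_prop
    rw [← lintegral_add_left hmeas, ← lintegral_add_right _ measurable_const]
    refine lintegral_mono fun θ => ?_
    have hθ : ‖(θ : EuclideanSpace ℝ (Fin N))‖ = 1 := by simp
    have e0 : barrier s ρ y x = (ρ ^ 2 - ‖x - y‖ ^ 2) ^ s := by
      rw [barrier, max_eq_left hW.le]
    have e1 : ∀ h : ℝ, barrier s ρ y (x - h • θ.1) =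
        max ((ρ ^ 2 - ‖x - y‖ ^ 2) + 2 * inner ℝ (x - y) θ.1 * h - h ^ 2) 0 ^ s := by
      intro h
      have := norm_sub_sq_real (x - y) (h • θ.1)
      rw [norm_smul, hθ, inner_smul_right, mul_one, Real.norm_eq_abs, sq_abs] at this
      rw [barrier, sub_right_comm, this]
      ring_nf
    have e2 : ∀ h : ℝ, barrier s ρ y (x + h • θ.1) =
        max ((ρ ^ 2 - ‖x - y‖ ^ 2) + 2 * -inner ℝ (x - y) θ.1 * h - h ^ 2) 0 ^ s := by
      intro h
      have := norm_add_sq_real (x - y) (h • θ.1)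
      rw [norm_smul, hθ, inner_smul_right, mul_one, Real.norm_eq_abs, sq_abs] at this
      rw [barrier, add_sub_right_comm, this]
      ring_nf
    simp only [e0, e1, e2]
    exact two_mul_lintegral_chord_le hε hW hs0 hs1 _
  rw [← hR1, ← hR2, ← two_mul, ← mul_add, ← hL] at key
  exact (ENNReal.mul_le_mul_iff_right two_ne_zero ENNReal.ofNat_ne_top).1 key

/-! ### The energy form -/

lemma integrable_truncKernel {N : ℕ} {s ε : ℝ} (hs : 0 < s) (hε : 0 < ε) :
    Integrable (truncKernel s ε : EuclideanSpace ℝ (Fin N) → ℝ) := by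
  have h1 : Integrable (fun z : EuclideanSpace ℝ (Fin N) =>
      (1 + ε⁻¹) ^ ((N : ℝ) + 2 * s) * (1 + ‖z‖) ^ (-((N : ℝ) + 2 * s))) := by
    refine (integrable_one_add_norm ?_).const_mul _
    rw [finrank_euclideanSpace, Fintype.card_fin]; linarith
  refine h1.mono' (measurable_truncKernel s ε).aestronglyMeasurable (ae_of_all _ fun z => ?_)
  rw [Real.norm_of_nonneg (truncKernel_nonneg _ _ _)]
  by_cases hz : ε < ‖z‖
  · have h0 : 0 < ‖z‖ := hε.trans hz
    rw [truncKernel, indicator_of_mem (show z ∈ {z | ε < ‖z‖} from hz), ← Real.rpow_neg h0.le,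
      Real.rpow_neg (by positivity), Real.rpow_neg (by positivity), ← div_eq_mul_inv,
      ← Real.div_rpow (by positivity) (by positivity), ← Real.inv_rpow (by positivity)]
    refine Real.rpow_le_rpow (by positivity) ?_ (by positivity)
    rw [inv_le_iff_one_le_mul₀ h0, div_mul_eq_mul_div, one_le_div (by positivity)]
    have : 1 ≤ ε⁻¹ * ‖z‖ := by
      rw [inv_mul_eq_div, one_le_div hε]; exact hz.le
    linarith
  · rw [truncKernel, indicator_of_notMem (show z ∉ {z | ε < ‖z‖} from hz)]
    positivity

lemma truncKernel_eventually {N : ℕ} (s : ℝ) {z : EuclideanSpace ℝ (Fin N)} (hz : z ≠ 0) :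
    ∀ᶠ n : ℕ in atTop, truncKernel s (1 / ((n : ℝ) + 1)) z = (‖z‖ ^ ((N : ℝ) + 2 * s))⁻¹ := by
  filter_upwards [(tendsto_one_div_add_atTop_nhds_zero_nat (𝕜 := ℝ)).eventually
    (gt_mem_nhds (norm_pos_iff.2 hz))] with n hn
  exact indicator_of_mem (show z ∈ {z | 1 / ((n : ℝ) + 1) < ‖z‖} from hn) _

lemma integrable_mul_truncKernel_sub {N : ℕ} {s ε : ℝ} (hs : 0 < s) (hε : 0 < ε)
    {φ : EuclideanSpace ℝ (Fin N) → ℝ} (hφ : Integrable φ) :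
    Integrable (fun p : EuclideanSpace ℝ (Fin N) × EuclideanSpace ℝ (Fin N) =>
      φ p.1 * truncKernel s ε (p.1 - p.2)) (volume.prod volume) := by
  have h := (measurePreserving_prod_sub (volume : Measure (EuclideanSpace ℝ (Fin N)))
    volume).integrable_comp_of_integrable
    (hφ.mul_prod (integrable_truncKernel (N := N) hs hε))
  refine h.congr (ae_of_all _ fun p => ?_)
  simp only [Function.comp]
  rw [← neg_sub p.1 p.2, truncKernel_neg]

lemma integrable_mul_sub_truncKernel {N : ℕ} {s ε M : ℝ} (hs : 0 < s) (hε : 0 < ε)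
    {f φ : EuclideanSpace ℝ (Fin N) → ℝ} (hf : Measurable f) (hfM : ∀ x, |f x| ≤ M)
    (hφ : Integrable φ) :
    Integrable (fun p : EuclideanSpace ℝ (Fin N) × EuclideanSpace ℝ (Fin N) =>
      φ p.1 * ((f p.1 - f p.2) * truncKernel s ε (p.1 - p.2))) (volume.prod volume) := by
  have h := (integrable_mul_truncKernel_sub hs hε hφ).bdd_mul
    (f := fun p : EuclideanSpace ℝ (Fin N) × EuclideanSpace ℝ (Fin N) => f p.1 - f p.2)
    (c := 2 * M) (by fun_prop) (ae_of_all _ fun p => ?_)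
  · refine h.congr (ae_of_all _ fun p => ?_)
    ring
  · rw [Real.norm_eq_abs]
    linarith [abs_sub (f p.1) (f p.2), hfM p.1, hfM p.2]

/-- The form splits into two terms that the swap of the variables exchanges. -/
lemma truncKernel_form_eq {N : ℕ} (s ε : ℝ) (f φ : EuclideanSpace ℝ (Fin N) → ℝ)
    (p : EuclideanSpace ℝ (Fin N) × EuclideanSpace ℝ (Fin N)) :
    (f p.1 - f p.2) * (φ p.1 - φ p.2) * truncKernel s ε (p.1 - p.2) =
      φ p.1 * ((f p.1 - f p.2) * truncKernel s ε (p.1 - p.2)) +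
      φ p.swap.1 * ((f p.swap.1 - f p.swap.2) * truncKernel s ε (p.swap.1 - p.swap.2)) := by
  rw [Prod.fst_swap, Prod.snd_swap, ← neg_sub p.1 p.2, truncKernel_neg]
  ring

lemma integrable_truncKernel_form {N : ℕ} {s ε M : ℝ} (hs : 0 < s) (hε : 0 < ε)
    {f φ : EuclideanSpace ℝ (Fin N) → ℝ} (hf : Measurable f) (hfM : ∀ x, |f x| ≤ M)
    (hφ : Integrable φ) :
    Integrable fun p : EuclideanSpace ℝ (Fin N) × EuclideanSpace ℝ (Fin N) =>
      (f p.1 - f p.2) * (φ p.1 - φ p.2) * truncKernel s ε (p.1 - p.2) := by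
  have h := integrable_mul_sub_truncKernel hs hε hf hfM hφ
  exact (h.add h.swap).congr (ae_of_all _ fun p => (truncKernel_form_eq s ε f φ p).symm)

/-- Testing the truncated form against `φ` amounts to integrating `φ` against the truncated
fractional Laplacian. -/
lemma integral_truncKernel_form {N : ℕ} {s ε M : ℝ} (hs : 0 < s) (hε : 0 < ε)
    {f φ : EuclideanSpace ℝ (Fin N) → ℝ} (hf : Measurable f) (hfM : ∀ x, |f x| ≤ M)
    (hφ : Integrable φ) :
    ∫ p : EuclideanSpace ℝ (Fin N) × EuclideanSpace ℝ (Fin N),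
      (f p.1 - f p.2) * (φ p.1 - φ p.2) * truncKernel s ε (p.1 - p.2) =
    2 * ∫ x, φ x * ∫ x', (f x - f x') * truncKernel s ε (x - x') := by
  have h := integrable_mul_sub_truncKernel hs hε hf hfM hφ
  simp_rw [truncKernel_form_eq]
  refine (integral_add h h.swap).trans ?_
  refine (congrArg _ (integral_prod_swap (μ := volume) (ν := volume)
    fun p : EuclideanSpace ℝ (Fin N) × EuclideanSpace ℝ (Fin N) =>
      φ p.1 * ((f p.1 - f p.2) * truncKernel s ε (p.1 - p.2)))).trans ?_
  simp only [integral_prod _ h, integral_const_mul]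
  rw [two_mul]

lemma integrable_truncKernel_sub_left {N : ℕ} {s ε : ℝ} (hs : 0 < s) (hε : 0 < ε)
    (x : EuclideanSpace ℝ (Fin N)) : Integrable fun x' => truncKernel s ε (x - x') :=
  (integrable_truncKernel hs hε).comp_sub_left x

/-- The bound of `lintegral_barrier_le` as an inequality between convergent integrals. -/
lemma integral_barrier_le {N : ℕ} (hN : 1 ≤ N) {s ε ρ : ℝ} (hs0 : 0 < s) (hs1 : s < 1)
    (hε : 0 < ε) {y x : EuclideanSpace ℝ (Fin N)} (hx : x ∈ ball y ρ) :
    ∫ x', (barrier s ρ y x - barrier s ρ y x') * truncKernel s ε (x - x') ≤ barrierConst N s := by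
  have hi1 : Integrable fun x' => barrier s ρ y x * truncKernel s ε (x - x') :=
    (integrable_truncKernel_sub_left hs0 hε x).const_mul _
  have hi2 : Integrable fun x' => barrier s ρ y x' * truncKernel s ε (x - x') := by
    refine (integrable_truncKernel_sub_left hs0 hε x).bdd_mul
      (c := (ρ ^ 2) ^ s) (continuous_barrier hs0 ρ y).aestronglyMeasurable
      (ae_of_all _ fun x' => ?_)
    rw [Real.norm_of_nonneg (barrier_nonneg _ _ _ _)]
    exact barrier_le hs0 y x'
  have hn1 : ∀ x', 0 ≤ barrier s ρ y x * truncKernel s ε (x - x') := fun x' =>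
    mul_nonneg (barrier_nonneg _ _ _ _) (truncKernel_nonneg _ _ _)
  have hn2 : ∀ x', 0 ≤ barrier s ρ y x' * truncKernel s ε (x - x') := fun x' =>
    mul_nonneg (barrier_nonneg _ _ _ _) (truncKernel_nonneg _ _ _)
  have hc : 0 ≤ barrierConst N s := by
    unfold barrierConst chordConst
    exact mul_nonneg (add_nonneg (div_nonneg zero_le_one (by linarith)) (by positivity))
      measureReal_nonneg
  have h := lintegral_barrier_le hN hs0 hs1 hε hx
  rw [← ofReal_integral_eq_lintegral_ofReal hi1 (ae_of_all _ hn1),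
    ← ofReal_integral_eq_lintegral_ofReal hi2 (ae_of_all _ hn2),
    ← ENNReal.ofReal_add (integral_nonneg hn2) hc,
    ENNReal.ofReal_le_ofReal_iff (add_nonneg (integral_nonneg hn2) hc)] at h
  simp_rw [sub_mul]
  rw [integral_sub hi1 hi2]
  linarith

lemma integral_truncKernel_barrier_le {N : ℕ} (hN : 1 ≤ N) {s ε ρ : ℝ} (hs0 : 0 < s) (hs1 : s < 1)
    (hε : 0 < ε) {y : EuclideanSpace ℝ (Fin N)} {φ : EuclideanSpace ℝ (Fin N) → ℝ}
    (hφ : Integrable φ) (hφ0 : ∀ x, 0 ≤ φ x) (hφs : ∀ x, x ∉ ball y ρ → φ x = 0) :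
    ∫ p : EuclideanSpace ℝ (Fin N) × EuclideanSpace ℝ (Fin N),
      (barrier s ρ y p.1 - barrier s ρ y p.2) * (φ p.1 - φ p.2) * truncKernel s ε (p.1 - p.2) ≤
    2 * barrierConst N s * ∫ x, φ x := by
  have hle : ∀ x, |barrier s ρ y x| ≤ (ρ ^ 2) ^ s := fun x => by
    rw [abs_of_nonneg (barrier_nonneg _ _ _ _)]; exact barrier_le hs0 y x
  rw [integral_truncKernel_form hs0 hε (continuous_barrier hs0 ρ y).measurable hle hφ, mul_assoc,
    ← integral_const_mul (barrierConst N s)]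
  have hi := (integrable_mul_sub_truncKernel hs0 hε (continuous_barrier hs0 ρ y).measurable hle
    hφ).integral_prod_left
  simp only [integral_const_mul] at hi
  refine mul_le_mul_of_nonneg_left (integral_mono hi (hφ.const_mul _) fun x => ?_) zero_le_two
  by_cases hx : x ∈ ball y ρ
  · simp only
    rw [mul_comm]
    exact mul_le_mul_of_nonneg_right (integral_barrier_le hN hs0 hs1 hε hx) (hφ0 x)
  · simp [hφs x hx]

lemma integrable_energy {N : ℕ} {s : ℝ} {f g : EuclideanSpace ℝ (Fin N) → ℝ}
    (hf : Measurable f) (hg : Measurable g) (hf' : gagliardoSq s f < ⊤)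
    (hg' : gagliardoSq s g < ⊤) :
    Integrable fun p : EuclideanSpace ℝ (Fin N) × EuclideanSpace ℝ (Fin N) =>
      (f p.1 - f p.2) * (g p.1 - g p.2) / ‖p.1 - p.2‖ ^ ((N : ℝ) + 2 * s) := by
  have key : ∀ {f : EuclideanSpace ℝ (Fin N) → ℝ}, Measurable f → gagliardoSq s f < ⊤ →
      Integrable fun p : EuclideanSpace ℝ (Fin N) × EuclideanSpace ℝ (Fin N) =>
        (f p.1 - f p.2) ^ 2 / ‖p.1 - p.2‖ ^ ((N : ℝ) + 2 * s) := by
    intro f hf h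
    refine ⟨Measurable.aestronglyMeasurable (by measurability), ?_⟩
    rw [hasFiniteIntegral_iff_ofReal (ae_of_all _ fun p => by positivity)]
    exact h
  refine ((key hf hf').add (key hg hg')).mono'
    (Measurable.aestronglyMeasurable (by measurability)) (ae_of_all _ fun p => ?_)
  simp only [Pi.add_apply]
  rw [← add_div, norm_div,
    Real.norm_of_nonneg (by positivity : 0 ≤ ‖p.1 - p.2‖ ^ ((N : ℝ) + 2 * s))]
  gcongr
  rw [Real.norm_eq_abs, abs_le]
  constructor <;> nlinarith [sq_nonneg ((f p.1 - f p.2) + (g p.1 - g p.2)),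
    sq_nonneg ((f p.1 - f p.2) - (g p.1 - g p.2)), sq_nonneg (f p.1 - f p.2),
    sq_nonneg (g p.1 - g p.2)]

lemma integrable_barrier {N : ℕ} {s ρ : ℝ} (hs : 0 < s) (hρ : 0 < ρ)
    (y : EuclideanSpace ℝ (Fin N)) : Integrable (barrier s ρ y) :=
  (continuous_barrier hs ρ y).integrable_of_hasCompactSupport
    (HasCompactSupport.intro (isCompact_closedBall y ρ) fun _ hx =>
      barrier_eq_zero hs hρ fun h => hx (ball_subset_closedBall h))

/-- The barrier has finite Gagliardo seminorm: its truncated energies are bounded by the integral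
of the barrier against its own truncated fractional Laplacian. -/
lemma gagliardoSq_barrier_lt_top {N : ℕ} (hN : 1 ≤ N) {s ρ : ℝ} (hs0 : 0 < s) (hs1 : s < 1)
    (hρ : 0 < ρ) (y : EuclideanSpace ℝ (Fin N)) : gagliardoSq s (barrier s ρ y) < ⊤ := by
  have hm := (continuous_barrier hs0 ρ y).measurable
  refine lt_of_le_of_lt ?_ (ENNReal.ofReal_lt_top
    (r := 2 * barrierConst N s * ∫ x, barrier s ρ y x))
  refine le_of_tendsto' (f := fun n : ℕ =>
    ∫⁻ p : EuclideanSpace ℝ (Fin N) × EuclideanSpace ℝ (Fin N),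
      ENNReal.ofReal ((barrier s ρ y p.1 - barrier s ρ y p.2) ^ 2 *
        truncKernel s (1 / ((n : ℝ) + 1)) (p.1 - p.2))) (x := atTop) ?_ fun n => ?_
  · refine lintegral_tendsto_of_tendsto_of_monotone (fun n => by fun_prop)
      (ae_of_all _ fun p m n hmn => ENNReal.ofReal_le_ofReal ?_) (ae_of_all _ fun p => ?_)
    · refine mul_le_mul_of_nonneg_left ?_ (sq_nonneg _)
      unfold truncKernel
      refine indicator_le_indicator_of_subset (fun z (hz : _ < ‖z‖) => ?_)
        (fun _ => by positivity) _
      exact (one_div_le_one_div_of_le (by positivity) (by gcongr)).trans_lt hz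
    · refine tendsto_nhds_of_eventually_eq ?_
      by_cases hp : p.1 = p.2
      · simp [hp]
      · filter_upwards [truncKernel_eventually s (sub_ne_zero.2 hp)] with n hn
        rw [hn, div_eq_mul_inv]
  · have hε : (0 : ℝ) < 1 / ((n : ℝ) + 1) := by positivity
    have hle : ∀ x, |barrier s ρ y x| ≤ (ρ ^ 2) ^ s := fun x => by
      rw [abs_of_nonneg (barrier_nonneg _ _ _ _)]; exact barrier_le hs0 y x
    have h := integral_truncKernel_barrier_le hN hs0 hs1 hε (integrable_barrier hs0 hρ y)
      (barrier_nonneg s ρ y) (fun x => barrier_eq_zero hs0 hρ)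
    rw [← ofReal_integral_eq_lintegral_ofReal]
    · simp_rw [← pow_two] at h
      exact ENNReal.ofReal_le_ofReal h
    · simpa only [pow_two] using integrable_truncKernel_form hs0 hε hm hle
        (integrable_barrier hs0 hρ y)
    · exact ae_of_all _ fun p => mul_nonneg (sq_nonneg _) (truncKernel_nonneg _ _ _)

/-- The barrier is a weak subsolution with bounded right-hand side in its ball. -/
lemma energyForm_barrier_le {N : ℕ} (hN : 1 ≤ N) {s ρ : ℝ} (hs0 : 0 < s) (hs1 : s < 1)
    (hρ : 0 < ρ) {y : EuclideanSpace ℝ (Fin N)} {φ : EuclideanSpace ℝ (Fin N) → ℝ}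
    (hφm : Measurable φ) (hφ : Integrable φ) (hφ0 : ∀ x, 0 ≤ φ x)
    (hφs : ∀ x, x ∉ ball y ρ → φ x = 0) (hφg : gagliardoSq s φ < ⊤) :
    energyForm s (barrier s ρ y) φ ≤ 2 * barrierConst N s * ∫ x, φ x := by
  have hm := (continuous_barrier hs0 ρ y).measurable
  have hi := integrable_energy hm hφm (gagliardoSq_barrier_lt_top hN hs0 hs1 hρ y) hφg
  refine le_of_tendsto' (f := fun n : ℕ =>
    ∫ p : EuclideanSpace ℝ (Fin N) × EuclideanSpace ℝ (Fin N),
      (barrier s ρ y p.1 - barrier s ρ y p.2) * (φ p.1 - φ p.2) *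
        truncKernel s (1 / ((n : ℝ) + 1)) (p.1 - p.2)) (x := atTop) ?_ fun n =>
    integral_truncKernel_barrier_le hN hs0 hs1 (by positivity) hφ hφ0 hφs
  refine tendsto_integral_of_dominated_convergence _ (fun n => by fun_prop) hi.norm
    (fun n => ae_of_all _ fun p => ?_) (ae_of_all _ fun p => ?_)
  · rw [norm_mul, div_eq_mul_inv (_ * _) (_ ^ (_ + _)), norm_mul _ (_ ^ _)⁻¹]
    refine mul_le_mul_of_nonneg_left ?_ (norm_nonneg _)
    rw [Real.norm_of_nonneg (truncKernel_nonneg _ _ _), Real.norm_of_nonneg (by positivity)]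
    exact truncKernel_le _
  · refine tendsto_nhds_of_eventually_eq ?_
    by_cases hp : p.1 = p.2
    · simp [hp]
    · filter_upwards [truncKernel_eventually s (sub_ne_zero.2 hp)] with n hn
      rw [hn, div_eq_mul_inv]

/-! ### Approximation by test functions -/

lemma eLpNorm_two_sq {X : Type*} [MeasurableSpace X] (f : X → ℝ) (μ : Measure X) :
    eLpNorm f 2 μ ^ 2 = ∫⁻ x, ‖f x‖ₑ ^ 2 ∂μ := by
  have h := eLpNorm_nnreal_pow_eq_lintegral (μ := μ) (f := f) (p := 2) two_ne_zero
  simpa using h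

/-- The difference quotient of order `s` whose `L²` norm is the Gagliardo seminorm. On the diagonal
it vanishes with its numerator, whatever the value of the power of `0`. -/
def diffQuot {N : ℕ} (s : ℝ) (f : EuclideanSpace ℝ (Fin N) → ℝ)
    (p : EuclideanSpace ℝ (Fin N) × EuclideanSpace ℝ (Fin N)) : ℝ :=
  (f p.1 - f p.2) * ‖p.1 - p.2‖ ^ (-((N : ℝ) + 2 * s) / 2)

lemma measurable_diffQuot {N : ℕ} (s : ℝ) {f : EuclideanSpace ℝ (Fin N) → ℝ} (hf : Measurable f) :
    Measurable (diffQuot s f) := by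
  unfold diffQuot; fun_prop

lemma diffQuot_sq {N : ℕ} (s : ℝ) (f : EuclideanSpace ℝ (Fin N) → ℝ)
    (p : EuclideanSpace ℝ (Fin N) × EuclideanSpace ℝ (Fin N)) :
    diffQuot s f p ^ 2 = (f p.1 - f p.2) ^ 2 / ‖p.1 - p.2‖ ^ ((N : ℝ) + 2 * s) := by
  rw [diffQuot, mul_pow, div_eq_mul_inv (_ ^ 2), ← Real.rpow_mul_natCast (norm_nonneg _),
    ← Real.rpow_neg (norm_nonneg (p.1 - p.2))]
  congr 2
  push_cast; ring

lemma gagliardoSq_eq {N : ℕ} (s : ℝ) (f : EuclideanSpace ℝ (Fin N) → ℝ) :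
    gagliardoSq s f = eLpNorm (diffQuot s f) 2 volume ^ 2 := by
  rw [eLpNorm_two_sq, gagliardoSq]
  refine lintegral_congr fun p => ?_
  rw [← diffQuot_sq, ← enorm_pow, Real.enorm_of_nonneg (sq_nonneg _)]

lemma memLp_diffQuot {N : ℕ} {s : ℝ} {f : EuclideanSpace ℝ (Fin N) → ℝ} (hf : Measurable f)
    (h : gagliardoSq s f < ⊤) : MemLp (diffQuot s f) 2 volume := by
  refine ⟨(measurable_diffQuot s hf).aestronglyMeasurable, ?_⟩
  rw [gagliardoSq_eq] at h
  by_contra h'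
  rw [not_lt, top_le_iff] at h'
  simp [h'] at h

lemma gagliardoSq_lt_top {N : ℕ} {s : ℝ} {f : EuclideanSpace ℝ (Fin N) → ℝ}
    (h : MemLp (diffQuot s f) 2 volume) : gagliardoSq s f < ⊤ := by
  rw [gagliardoSq_eq]; exact ENNReal.pow_lt_top h.2

lemma tendsto_eLpNorm_two_zero {X : Type*} [MeasurableSpace X] {μ : Measure X} {F : ℕ → X → ℝ}
    {G : X → ℝ} (hF : ∀ n, Measurable (F n)) (hG : MemLp G 2 μ) (hle : ∀ n x, |F n x| ≤ |G x|)
    (hlim : ∀ x, Tendsto (fun n => F n x) atTop (𝓝 0)) :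
    Tendsto (fun n => eLpNorm (F n) 2 μ) atTop (𝓝 0) := by
  have h : Tendsto (fun n => eLpNorm (F n) 2 μ ^ 2) atTop (𝓝 0) := by
    simp_rw [eLpNorm_two_sq]
    rw [← lintegral_zero (μ := μ)]
    refine tendsto_lintegral_of_dominated_convergence (fun x => ‖G x‖ₑ ^ 2)
      (fun n => by fun_prop) (fun n => ae_of_all _ fun x => ?_) ?_ (ae_of_all _ fun x => ?_)
    · exact pow_le_pow_left' (enorm_le_iff_norm_le.2 (hle n x)) 2
    · rw [← eLpNorm_two_sq]; exact (ENNReal.pow_lt_top hG.2).ne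
    · have := (ENNReal.continuous_pow 2).tendsto _ |>.comp (hlim x).enorm
      simpa [Function.comp_def] using this
  have h2 := h.ennrpow_const (1 / 2)
  simpa [← ENNReal.rpow_natCast_mul] using h2

/-- Minkowski's inequality in `L²` for averages over a probability measure. -/
lemma eLpNorm_integral_le {X H : Type*} [MeasurableSpace X] [MeasurableSpace H] {μ : Measure X}
    [SFinite μ] {ν : Measure H} [IsProbabilityMeasure ν] {D : H → X → ℝ}
    (hD : Measurable (Function.uncurry D)) {ε : ℝ≥0∞} (hε : ∀ᵐ h ∂ν, eLpNorm (D h) 2 μ ≤ ε) :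
    eLpNorm (fun x => ∫ h, D h x ∂ν) 2 μ ≤ ε := by
  rw [← ENNReal.pow_le_pow_left_iff two_ne_zero, eLpNorm_two_sq]
  calc ∫⁻ x, ‖∫ h, D h x ∂ν‖ₑ ^ 2 ∂μ ≤ ∫⁻ x, ∫⁻ h, ‖D h x‖ₑ ^ 2 ∂ν ∂μ := by
        refine lintegral_mono fun x => ?_
        simp only
        rw [← eLpNorm_two_sq]
        gcongr
        refine (enorm_integral_le_lintegral_enorm _).trans ?_
        rw [← eLpNorm_one_eq_lintegral_enorm]
        exact eLpNorm_le_eLpNorm_of_exponent_le one_le_two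
          (hD.comp measurable_prodMk_right).aestronglyMeasurable
    _ = ∫⁻ h, ∫⁻ x, ‖D h x‖ₑ ^ 2 ∂μ ∂ν := by
        refine lintegral_lintegral_swap ?_
        exact ((hD.comp measurable_swap).enorm.pow_const 2).aemeasurable
    _ ≤ ∫⁻ h, ε ^ 2 ∂ν := by
        refine lintegral_mono_ae ?_
        filter_upwards [hε] with h hh
        rw [← eLpNorm_two_sq]
        gcongr
    _ = ε ^ 2 := by simp

/-- Continuity of measure-preserving actions in `L²`. -/
lemma tendsto_eLpNorm_sub_comp {X H : Type*} [TopologicalSpace X] [R1Space X] [MeasurableSpace X]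
    [BorelSpace X] {μ : Measure X} [IsLocallyFiniteMeasure μ] [μ.InnerRegularCompactLTTop]
    [TopologicalSpace H] {τ : H → X → X} (hτ : Continuous fun p : H × X => τ p.1 p.2) {h₀ : H}
    (hτ0 : ∀ x, τ h₀ x = x) (hmp : ∀ h, MeasurePreserving (τ h) μ μ) {F : X → ℝ}
    (hF : MemLp F 2 μ) :
    Tendsto (fun h => eLpNorm (fun x => F x - F (τ h x)) 2 μ) (𝓝 h₀) (𝓝 0) := by
  let g : C(H, C(X, X)) := (ContinuousMap.mk (fun p : H × X => τ p.1 p.2) hτ).curry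
  have hc : Continuous fun h => Lp.compMeasurePreserving (g h) (hmp h) (hF.toLp F) :=
    continuous_const.compMeasurePreservingLp g.continuous hmp ENNReal.ofNat_ne_top
  have ht := (hc.tendsto h₀).edist (tendsto_const_nhds (x := hF.toLp F))
  have e : ∀ h, Lp.compMeasurePreserving (g h) (hmp h) (hF.toLp F) =
      (hF.comp_measurePreserving (hmp h)).toLp _ := fun h =>
    Lp.toLp_compMeasurePreserving hF (hmp h)
  have e0 : Lp.compMeasurePreserving (g h₀) (hmp h₀) (hF.toLp F) = hF.toLp F := by
    rw [e]
    congr 1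
    funext x
    simp [hτ0]
  rw [e0, edist_self] at ht
  refine ht.congr fun h => ?_
  rw [edist_comm, e, Lp.edist_toLp_toLp]
  rfl

/-- Mollification: a continuous function with compact support in `Ω` is approximated in `Hˢ` by
test functions. -/
lemma exists_testFunction_of_compactSupport {N : ℕ} {s : ℝ} {Ω : Set (EuclideanSpace ℝ (Fin N))}
    (hΩ : IsOpen Ω) {ψ : EuclideanSpace ℝ (Fin N) → ℝ} (hc : Continuous ψ)
    (hcs : HasCompactSupport ψ) (hsub : tsupport ψ ⊆ Ω) (h2 : MemLp ψ 2 volume)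
    (hT : MemLp (diffQuot s ψ) 2 volume) {ε : ℝ≥0∞} (hε : 0 < ε) :
    ∃ η : EuclideanSpace ℝ (Fin N) → ℝ, IsTestFunction Ω η ∧
      eLpNorm (fun x => ψ x - η x) 2 volume ≤ ε ∧
      eLpNorm (diffQuot s fun x => ψ x - η x) 2 volume ≤ ε := by
  obtain ⟨r₀, hr₀, hthick⟩ := hcs.isCompact.exists_cthickening_subset_open hΩ hsub
  have t1 := tendsto_eLpNorm_sub_comp (μ := (volume : Measure (EuclideanSpace ℝ (Fin N))))
    (τ := fun h x => x - h) (h₀ := (0 : EuclideanSpace ℝ (Fin N))) (by fun_prop) (by simp)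
    (fun h => measurePreserving_sub_right volume h) h2
  have t2 := tendsto_eLpNorm_sub_comp
    (μ := (volume : Measure (EuclideanSpace ℝ (Fin N) × EuclideanSpace ℝ (Fin N))))
    (τ := fun (h : EuclideanSpace ℝ (Fin N)) p => (p.1 - h, p.2 - h)) (h₀ := 0) (by fun_prop)
    (by simp) (fun h => (measurePreserving_sub_right volume h).prod
      (measurePreserving_sub_right volume h)) hT
  obtain ⟨r₁, hr₁, hball⟩ := Metric.eventually_nhds_iff.1
    ((t1.eventually (ge_mem_nhds hε)).and (t2.eventually (ge_mem_nhds hε)))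
  set r := min r₀ r₁ with hr
  have hrpos : 0 < r := lt_min hr₀ hr₁
  let b : ContDiffBump (0 : EuclideanSpace ℝ (Fin N)) :=
    ⟨r / 2, r, half_pos hrpos, half_lt_self hrpos⟩
  set ν : Measure (EuclideanSpace ℝ (Fin N)) :=
    volume.withDensity fun h => ENNReal.ofReal (b.normed volume h) with hν
  have hbm : Measurable fun h => ENNReal.ofReal (b.normed volume h) :=
    b.continuous_normed.measurable.ennreal_ofReal
  have hprob : IsProbabilityMeasure ν := by
    refine ⟨?_⟩
    rw [hν, withDensity_apply _ MeasurableSet.univ, Measure.restrict_univ,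
      ← ofReal_integral_eq_lintegral_ofReal b.integrable_normed (ae_of_all _ b.nonneg_normed),
      b.integral_normed, ENNReal.ofReal_one]
  have hνball : ∀ᵐ h ∂ν, dist h 0 < r := by
    rw [hν, ae_withDensity_iff hbm]
    refine ae_of_all _ fun h hh => ?_
    have : h ∈ Function.support (b.normed volume) := fun h0 => hh (by simp [h0])
    rwa [b.support_normed_eq] at this
  set η : EuclideanSpace ℝ (Fin N) → ℝ :=
    MeasureTheory.convolution (b.normed volume) ψ (ContinuousLinearMap.lsmul ℝ ℝ) volume with hη
  have hηe : ∀ x, η x = ∫ h, ψ (x - h) ∂ν := by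
    intro x
    rw [hη, hν, integral_withDensity_eq_integral_toReal_smul hbm (by simp)]
    refine integral_congr_ae (ae_of_all _ fun h => ?_)
    simp [ENNReal.toReal_ofReal (b.nonneg_normed h)]
  obtain ⟨M, hM⟩ := hcs.exists_bound_of_continuous hc
  have hint : ∀ x, Integrable (fun h => ψ (x - h)) ν := fun x =>
    (integrable_const M).mono' (by fun_prop) (ae_of_all _ fun h => hM _)
  have hdiff : ∀ x, ψ x - η x = ∫ h, (ψ x - ψ (x - h)) ∂ν := by
    intro x
    rw [integral_sub (integrable_const _) (hint x), hηe]
    simp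
  have hquot : ∀ p, diffQuot s (fun x => ψ x - η x) p =
      ∫ h, (diffQuot s ψ p - diffQuot s ψ (p.1 - h, p.2 - h)) ∂ν := by
    intro p
    have hi : ∀ x, Integrable (fun h => ψ x - ψ (x - h)) ν := fun x =>
      (integrable_const _).sub (hint x)
    simp only [diffQuot]
    rw [hdiff, hdiff, ← integral_sub (hi _) (hi _), ← integral_mul_const]
    refine integral_congr_ae (ae_of_all _ fun h => ?_)
    simp only [sub_sub_sub_cancel_right]
    ring
  have hsupp : Function.support η ⊆ cthickening r₀ (tsupport ψ) := by
    intro x hx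
    by_contra hx'
    refine hx ?_
    rw [hηe]
    refine integral_eq_zero_of_ae ?_
    filter_upwards [hνball] with h hh
    refine image_eq_zero_of_notMem_tsupport fun hmem => hx' ?_
    refine mem_cthickening_of_dist_le _ _ _ _ hmem ?_
    rw [dist_eq_norm, sub_sub_cancel, ← dist_zero_right]
    exact hh.le.trans (min_le_left _ _)
  have htsupp : tsupport η ⊆ cthickening r₀ (tsupport ψ) :=
    closure_minimal hsupp isClosed_cthickening
  refine ⟨η, ⟨b.hasCompactSupport_normed.contDiff_convolution_left _ b.contDiff_normed
    hc.locallyIntegrable, hcs.isCompact.cthickening.of_isClosed_subset (isClosed_tsupport _) htsupp,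
    htsupp.trans hthick⟩, ?_, ?_⟩
  · simp_rw [hdiff]
    refine eLpNorm_integral_le (D := fun h x => ψ x - ψ (x - h)) ?_ ?_
    · exact Continuous.measurable (by unfold Function.uncurry; fun_prop)
    · filter_upwards [hνball] with h hh
      exact (hball (hh.trans_le (min_le_right _ _))).1
  · rw [show diffQuot s (fun x => ψ x - η x) = fun p =>
      ∫ h, (diffQuot s ψ p - diffQuot s ψ (p.1 - h, p.2 - h)) ∂ν from funext hquot]
    refine eLpNorm_integral_le
      (D := fun h p => diffQuot s ψ p - diffQuot s ψ (p.1 - h, p.2 - h)) ?_ ?_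
    · have := measurable_diffQuot s hc.measurable
      unfold Function.uncurry; fun_prop
    · filter_upwards [hνball] with h hh
      exact (hball (hh.trans_le (min_le_right _ _))).2

/-- A nonnegative continuous function of `Hˢ` that has compact support and vanishes outside `Ω`
belongs to `Hˢ₀(Ω)`. Its truncations `(φ - t)₊`, `t > 0`, have compact support in `Ω`. -/
lemma memHs0_of_continuous {N : ℕ} {s : ℝ} {Ω : Set (EuclideanSpace ℝ (Fin N))}
    (hΩ : IsOpen Ω) {φ : EuclideanSpace ℝ (Fin N) → ℝ} (hc : Continuous φ)
    (hcs : HasCompactSupport φ) (h0 : ∀ x, 0 ≤ φ x) (hz : ∀ x, x ∉ Ω → φ x = 0)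
    (hφ : MemHs s φ) : MemHs0 s Ω φ := by
  have hT := memLp_diffQuot hc.measurable hφ.2
  have ht : Tendsto (fun n : ℕ => 1 / ((n : ℝ) + 1)) atTop (𝓝 0) :=
    tendsto_one_div_add_atTop_nhds_zero_nat
  have hmin : ∀ x, Tendsto (fun n : ℕ => min (φ x) (1 / ((n : ℝ) + 1))) atTop (𝓝 0) := fun x => by
    simpa [min_eq_right (h0 x)] using (tendsto_const_nhds (x := φ x)).min ht
  have hpos : ∀ n : ℕ, (0 : ℝ) < 1 / ((n : ℝ) + 1) := fun n => by positivity
  have a1 : Tendsto (fun n : ℕ => eLpNorm (fun x => min (φ x) (1 / ((n : ℝ) + 1))) 2 volume)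
      atTop (𝓝 0) := by
    refine tendsto_eLpNorm_two_zero (fun n => (hc.min continuous_const).measurable) hφ.1
      (fun n x => ?_) hmin
    rw [abs_of_nonneg (le_min (h0 x) (hpos n).le), abs_of_nonneg (h0 x)]
    exact min_le_left _ _
  have a2 : Tendsto (fun n : ℕ => eLpNorm (diffQuot s fun x => min (φ x) (1 / ((n : ℝ) + 1))) 2
      volume) atTop (𝓝 0) := by
    refine tendsto_eLpNorm_two_zero (fun n => measurable_diffQuot s
      (hc.min continuous_const).measurable) hT (fun n p => ?_) fun p => ?_
    · rw [diffQuot, diffQuot, abs_mul, abs_mul]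
      refine mul_le_mul_of_nonneg_right ?_ (abs_nonneg _)
      simpa using abs_min_sub_min_le_max (φ p.1) (1 / ((n : ℝ) + 1)) (φ p.2) (1 / ((n : ℝ) + 1))
    · simpa [diffQuot] using ((hmin p.1).sub (hmin p.2)).mul_const
        (‖p.1 - p.2‖ ^ (-((N : ℝ) + 2 * s) / 2))
  have key : ∀ n : ℕ, ∃ η : EuclideanSpace ℝ (Fin N) → ℝ, IsTestFunction Ω η ∧
      eLpNorm (fun x => φ x - η x) 2 volume ≤
        eLpNorm (fun x => min (φ x) (1 / ((n : ℝ) + 1))) 2 volume +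
          ENNReal.ofReal (1 / ((n : ℝ) + 1)) ∧
      eLpNorm (diffQuot s fun x => φ x - η x) 2 volume ≤
        eLpNorm (diffQuot s fun x => min (φ x) (1 / ((n : ℝ) + 1))) 2 volume +
          ENNReal.ofReal (1 / ((n : ℝ) + 1)) := by
    intro n
    set t : ℝ := 1 / ((n : ℝ) + 1) with htdef
    have htp : 0 < t := hpos n
    have hψc : Continuous fun x => φ x - min (φ x) t := by fun_prop
    have hsub : tsupport (fun x => φ x - min (φ x) t) ⊆ {x | t ≤ φ x} := by
      refine closure_minimal (fun x hx => ?_) (isClosed_le continuous_const hc)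
      by_contra h
      have h' : φ x < t := not_le.1 h
      exact hx (by simp [min_eq_left h'.le])
    have hmm : Measurable fun x => min (φ x) t := (hc.min continuous_const).measurable
    have hφm := hc.measurable
    have b1 : MemLp (fun x => φ x - min (φ x) t) 2 volume :=
      hφ.1.mono hψc.aestronglyMeasurable (ae_of_all _ fun x => by
        rw [Real.norm_of_nonneg (sub_nonneg.2 (min_le_left _ _)), Real.norm_of_nonneg (h0 x)]
        linarith [le_min (h0 x) htp.le])
    have b2 : MemLp (diffQuot s fun x => φ x - min (φ x) t) 2 volume := by
      refine hT.mono (measurable_diffQuot s hψc.measurable).aestronglyMeasurable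
        (ae_of_all _ fun p => ?_)
      rw [diffQuot, diffQuot, norm_mul, norm_mul]
      gcongr
      have e : ∀ x, φ x - min (φ x) t = max (φ x) t - t := fun x => by
        linarith [min_add_max (φ x) t]
      rw [e, e, sub_sub_sub_cancel_right]
      simpa using abs_max_sub_max_le_max (φ p.1) t (φ p.2) t
    have hψcs : HasCompactSupport fun x => φ x - min (φ x) t := by
      refine hcs.mono fun x hx h => hx ?_
      simp only [h, min_eq_left htp.le, sub_zero]
    obtain ⟨η, hη, e1, e2⟩ := exists_testFunction_of_compactSupport hΩ hψc hψcs
      (hsub.trans fun x hx => by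
        by_contra h
        exact absurd (hz x h) (htp.trans_le hx).ne') b1 b2
      (ENNReal.ofReal_pos.2 htp)
    have hηm : Measurable η := hη.1.continuous.measurable
    refine ⟨η, hη, ?_, ?_⟩
    · have e : (fun x => φ x - η x) = (fun x => min (φ x) t) +
          fun x => φ x - min (φ x) t - η x := by
        funext x; simp only [Pi.add_apply]; ring
      rw [e]
      refine (eLpNorm_add_le hmm.aestronglyMeasurable ?_ one_le_two).trans (by gcongr)
      fun_prop
    · have e : (diffQuot s fun x => φ x - η x) = (diffQuot s fun x => min (φ x) t) +
          diffQuot s fun x => φ x - min (φ x) t - η x := by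
        funext p; simp only [Pi.add_apply, diffQuot]; ring
      rw [e]
      refine (eLpNorm_add_le (measurable_diffQuot s hmm).aestronglyMeasurable
        (measurable_diffQuot s (by fun_prop)).aestronglyMeasurable one_le_two).trans (by gcongr)
  choose η hη e1 e2 using key
  have ht' : Tendsto (fun n : ℕ => ENNReal.ofReal (1 / ((n : ℝ) + 1))) atTop (𝓝 0) := by
    simpa using ENNReal.tendsto_ofReal ht
  refine ⟨hφ, η, hη, ?_, ?_⟩
  · exact tendsto_of_tendsto_of_tendsto_of_le_of_le tendsto_const_nhds
      (by simpa using a1.add ht') (fun n => zero_le) e1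
  · simp_rw [gagliardoSq_eq]
    have h := tendsto_of_tendsto_of_tendsto_of_le_of_le tendsto_const_nhds
      (by simpa using a2.add ht') (fun n => zero_le) e2
    have := (ENNReal.continuous_pow 2).tendsto _ |>.comp h
    simpa [Function.comp_def] using this

/-! ### Comparison with the barrier -/

/-- The test function `(w - u⁺)₊` for the barrier `w`. -/
def excess {N : ℕ} (s ρ : ℝ) (y : EuclideanSpace ℝ (Fin N)) (u : EuclideanSpace ℝ (Fin N) → ℝ)
    (x : EuclideanSpace ℝ (Fin N)) : ℝ :=
  max (barrier s ρ y x - max (u x) 0) 0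

section excess
variable {N : ℕ} {s ρ : ℝ} {y : EuclideanSpace ℝ (Fin N)} {u : EuclideanSpace ℝ (Fin N) → ℝ}

lemma excess_nonneg (x : EuclideanSpace ℝ (Fin N)) : 0 ≤ excess s ρ y u x := le_max_right _ _

lemma continuous_excess (hs : 0 < s) (hu : Continuous u) : Continuous (excess s ρ y u) := by
  have := continuous_barrier hs ρ y
  unfold excess; fun_prop

lemma excess_eq_zero (hs : 0 < s) (hρ : 0 < ρ) {x : EuclideanSpace ℝ (Fin N)}
    (hx : x ∉ ball y ρ) : excess s ρ y u x = 0 := by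
  rw [excess, barrier_eq_zero hs hρ hx]
  exact max_eq_right (by simp)

lemma hasCompactSupport_excess (hs : 0 < s) (hρ : 0 < ρ) :
    HasCompactSupport (excess s ρ y u) :=
  HasCompactSupport.intro (isCompact_closedBall y ρ) fun _ hx =>
    excess_eq_zero hs hρ fun h => hx (ball_subset_closedBall h)

lemma memHs_excess (hN : 1 ≤ N) (hs0 : 0 < s) (hs1 : s < 1) (hρ : 0 < ρ) (hu : Continuous u)
    (huH : MemHs s u) : MemHs s (excess s ρ y u) := by
  have hc : Continuous (excess s ρ y u) := continuous_excess hs0 hu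
  refine ⟨hc.memLp_of_hasCompactSupport (hasCompactSupport_excess hs0 hρ), gagliardoSq_lt_top ?_⟩
  have hw := memLp_diffQuot (continuous_barrier hs0 ρ y).measurable
    (gagliardoSq_barrier_lt_top hN hs0 hs1 hρ y)
  have hu' := memLp_diffQuot hu.measurable huH.2
  refine (hw.norm.add hu'.norm).mono (measurable_diffQuot s hc.measurable).aestronglyMeasurable
    (ae_of_all _ fun p => ?_)
  simp only [Pi.add_apply, diffQuot, norm_mul]
  rw [← add_mul, norm_mul, norm_norm]
  refine mul_le_mul_of_nonneg_right ?_ (norm_nonneg _)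
  rw [Real.norm_of_nonneg (by positivity : 0 ≤ ‖barrier s ρ y p.1 - barrier s ρ y p.2‖ +
    ‖u p.1 - u p.2‖)]
  simp only [Real.norm_eq_abs, excess]
  calc |max (barrier s ρ y p.1 - max (u p.1) 0) 0 - max (barrier s ρ y p.2 - max (u p.2) 0) 0|
      ≤ |(barrier s ρ y p.1 - max (u p.1) 0) - (barrier s ρ y p.2 - max (u p.2) 0)| := by
        simpa using abs_max_sub_max_le_max (barrier s ρ y p.1 - max (u p.1) 0) 0
          (barrier s ρ y p.2 - max (u p.2) 0) 0
    _ = |(barrier s ρ y p.1 - barrier s ρ y p.2) - (max (u p.1) 0 - max (u p.2) 0)| := by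
        congr 1; ring
    _ ≤ |barrier s ρ y p.1 - barrier s ρ y p.2| + |max (u p.1) 0 - max (u p.2) 0| := abs_sub _ _
    _ ≤ _ := by
        refine add_le_add le_rfl ?_
        simpa using abs_max_sub_max_le_max (u p.1) 0 (u p.2) 0

end excess

/-- The algebraic inequality behind the comparison: `g = w - u` agrees with `φ` where `φ > 0`, and
lies below `-k` elsewhere. -/
lemma form_ge {g₁ g₂ φ₁ φ₂ k₁ k₂ : ℝ} (h₁ : (φ₁ = g₁ ∧ 0 ≤ φ₁ ∧ k₁ = 0) ∨ (φ₁ = 0 ∧ g₁ ≤ -k₁))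
    (h₂ : (φ₂ = g₂ ∧ 0 ≤ φ₂ ∧ k₂ = 0) ∨ (φ₂ = 0 ∧ g₂ ≤ -k₂)) :
    φ₁ * k₂ + φ₂ * k₁ ≤ (g₁ - g₂) * (φ₁ - φ₂) := by
  rcases h₁ with ⟨rfl, h1, rfl⟩ | ⟨rfl, h1⟩ <;> rcases h₂ with ⟨rfl, h2, rfl⟩ | ⟨rfl, h2⟩
  · nlinarith [sq_nonneg (φ₁ - φ₂)]
  · nlinarith
  · nlinarith
  · simp

/-- If the supersolution `u` lies above `k` outside the ball `B_ρ(y) ⊆ Ω`, and the interaction of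
`k` with every point of the ball is large compared with the zeroth order term and with the
fractional Laplacian of the barrier, then `u` lies above the barrier. -/
lemma barrier_le_of_interaction {N : ℕ} (hN : 1 ≤ N) {s ρ : ℝ} (hs0 : 0 < s) (hs1 : s < 1)
    {Ω : Set (EuclideanSpace ℝ (Fin N))} (hΩ : IsOpen Ω) {c u : EuclideanSpace ℝ (Fin N) → ℝ}
    {C : ℝ} (hC : 0 ≤ C) (hc : ∀ᵐ x ∂(volume.restrict Ω), |c x| ≤ C) (hu : Continuous u)
    (hsup : IsSupersolution s Ω c u) {y : EuclideanSpace ℝ (Fin N)} (hρ : 0 < ρ) (hρ1 : ρ ≤ 1)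
    (hball : ball y ρ ⊆ Ω) (hu0 : ∀ x ∈ ball y ρ, 0 ≤ u x)
    {k G : EuclideanSpace ℝ (Fin N) → ℝ} (hk : Measurable k) (hk0 : ∀ x ∈ ball y ρ, k x = 0)
    (hku : ∀ x, x ∉ ball y ρ → k x ≤ u x) (hG : Integrable G)
    (hkG : ∀ x ∈ ball y ρ, ∀ x', |k x'| / ‖x - x'‖ ^ ((N : ℝ) + 2 * s) ≤ G x') {m : ℝ}
    (hm : ∀ x ∈ ball y ρ, m ≤ ∫ x', k x' / ‖x - x'‖ ^ ((N : ℝ) + 2 * s))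
    (hmC : 2 * barrierConst N s + C < 2 * m) :
    ∀ x ∈ ball y ρ, barrier s ρ y x ≤ u x := by
  set φ := excess s ρ y u with hφ
  set w := barrier s ρ y with hw
  have hφc : Continuous φ := continuous_excess hs0 hu
  have hφcs : HasCompactSupport φ := hasCompactSupport_excess hs0 hρ
  have hφ0 : ∀ x, 0 ≤ φ x := excess_nonneg
  have hφz : ∀ x, x ∉ ball y ρ → φ x = 0 := fun x => excess_eq_zero hs0 hρ
  have hφi : Integrable φ := hφc.integrable_of_hasCompactSupport hφcs
  have hφH : MemHs s φ := memHs_excess hN hs0 hs1 hρ hu hsup.1.1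
  have hwm : Measurable w := (continuous_barrier hs0 ρ y).measurable
  have hφ0H : MemHs0 s Ω φ := memHs0_of_continuous hΩ hφc hφcs hφ0
    (fun x hx => hφz x fun h => hx (hball h)) hφH
  have hiw := integrable_energy hwm hφc.measurable
    (gagliardoSq_barrier_lt_top hN hs0 hs1 hρ y) hφH.2
  have hiu := integrable_energy hu.measurable hφc.measurable hsup.1.1.2 hφH.2
  -- the interaction of `φ` with `k`
  set Q : EuclideanSpace ℝ (Fin N) × EuclideanSpace ℝ (Fin N) → ℝ := fun p =>
    φ p.1 * (k p.2 / ‖p.1 - p.2‖ ^ ((N : ℝ) + 2 * s)) with hQ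
  have hQi : Integrable Q (volume.prod volume) := by
    refine (hφi.mul_prod hG).mono' (Measurable.aestronglyMeasurable ?_) (ae_of_all _ fun p => ?_)
    · have := hφc.measurable
      exact (by fun_prop : Measurable fun p : EuclideanSpace ℝ (Fin N) ×
        EuclideanSpace ℝ (Fin N) => φ p.1).mul
        ((hk.comp measurable_snd).div (by fun_prop))
    · simp only [hQ, norm_mul, norm_div, Real.norm_eq_abs]
      rw [abs_of_nonneg (hφ0 _),
        abs_of_nonneg (by positivity : 0 ≤ ‖p.1 - p.2‖ ^ ((N : ℝ) + 2 * s))]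
      by_cases hp : p.1 ∈ ball y ρ
      · exact mul_le_mul_of_nonneg_left (hkG _ hp _) (hφ0 _)
      · simp [hφz _ hp]
  have hpt : ∀ x, (φ x = w x - u x ∧ 0 ≤ φ x ∧ k x = 0) ∨ (φ x = 0 ∧ w x - u x ≤ -k x) := by
    intro x
    by_cases hx : x ∈ ball y ρ
    · have e : φ x = max (w x - u x) 0 := by
        rw [hφ, excess, max_eq_left (hu0 x hx)]
      rw [e, hk0 x hx]
      rcases le_total (w x - u x) 0 with h | h
      · right; simpa using h
      · left; simpa using h
    · right
      refine ⟨hφz x hx, ?_⟩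
      rw [hw, barrier_eq_zero hs0 hρ hx]
      linarith [hku x hx]
  have hlow : 2 * m * ∫ x, φ x ≤ energyForm s w φ - energyForm s u φ := by
    have h1 : ∫ p, (Q p + (Q ∘ Prod.swap) p) = 2 * ∫ p, Q p := by
      rw [Measure.volume_eq_prod, integral_add hQi hQi.swap, two_mul]
      exact congrArg _ (integral_prod_swap Q)
    have h2 : m * ∫ x, φ x ≤ ∫ p, Q p := by
      rw [Measure.volume_eq_prod, integral_prod _ hQi, ← integral_const_mul]
      refine integral_mono (hφi.const_mul _) hQi.integral_prod_left fun x => ?_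
      simp only [hQ, integral_const_mul]
      by_cases hx : x ∈ ball y ρ
      · rw [mul_comm]
        exact mul_le_mul_of_nonneg_left (hm x hx) (hφ0 x)
      · simp [hφz _ hx]
    have h3 : ∫ p, (Q p + (Q ∘ Prod.swap) p) ≤ energyForm s w φ - energyForm s u φ := by
      rw [energyForm, energyForm, ← integral_sub hiw hiu]
      refine integral_mono (hQi.add hQi.swap) (hiw.sub hiu) fun p => ?_
      simp only [hQ, Function.comp, Prod.fst_swap, Prod.snd_swap]
      rw [norm_sub_rev p.2 p.1, mul_div_assoc', mul_div_assoc', ← add_div, ← sub_div]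
      refine div_le_div_of_nonneg_right ?_ (by positivity)
      have := form_ge (hpt p.1) (hpt p.2)
      linarith
    rw [h1] at h3
    linarith
  have hup : energyForm s w φ ≤ 2 * barrierConst N s * ∫ x, φ x :=
    energyForm_barrier_le hN hs0 hs1 hρ hφc.measurable hφi hφ0 hφz hφH.2
  have hzero : -(C * ∫ x, φ x) ≤ energyForm s u φ := by
    refine le_trans ?_ (hsup.2.2 φ hφ0H (ae_of_all _ hφ0))
    have h1 : ‖∫ x in Ω, c x * u x * φ x‖ ≤ ∫ x in Ω, C * φ x := by
      refine norm_integral_le_of_norm_le (hφi.const_mul C).integrableOn ?_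
      filter_upwards [hc] with x hx
      rw [norm_mul, norm_mul, Real.norm_eq_abs, Real.norm_eq_abs, Real.norm_of_nonneg (hφ0 x)]
      rcases (hφ0 x).eq_or_lt with h | h
      · simp [← h]
      · have hxb : x ∈ ball y ρ := by
          by_contra h'
          exact h.ne' (hφz x h')
        have hux := hu0 x hxb
        have hlt : u x < w x := by
          rw [hφ, excess, max_eq_left hux, lt_max_iff] at h
          rcases h with h | h
          · linarith
          · exact absurd h (lt_irrefl _)
        have hw1 : w x ≤ 1 := (barrier_le hs0 y x).trans
          (Real.rpow_le_one (by positivity) (by nlinarith) hs0.le)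
        rw [abs_of_nonneg hux]
        have : |c x| * u x ≤ C * 1 := mul_le_mul hx (by linarith) hux hC
        rw [mul_one] at this
        exact mul_le_mul_of_nonneg_right this h.le
    have h2 : ∫ x in Ω, C * φ x ≤ ∫ x, C * φ x :=
      setIntegral_le_integral (hφi.const_mul C) (ae_of_all _ fun x => mul_nonneg hC (hφ0 x))
    have h3 := integral_const_mul (μ := volume) C φ
    rw [Real.norm_eq_abs] at h1
    linarith [neg_abs_le (∫ x in Ω, c x * u x * φ x)]
  have hnn : 0 ≤ ∫ x, φ x := integral_nonneg hφ0
  have hI : ∫ x, φ x = 0 := by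
    by_contra h
    have hpos : 0 < ∫ x, φ x := lt_of_le_of_ne hnn (Ne.symm h)
    nlinarith
  have hφzero : φ = 0 := by
    by_contra h
    exact (hφc.integral_pos_of_hasCompactSupport_nonneg_nonzero hφcs hφ0
      (x := (Function.ne_iff.1 h).choose) (Function.ne_iff.1 h).choose_spec).ne' hI
  intro x hx
  have h := congrFun hφzero x
  rw [hφ, excess, max_eq_left (hu0 x hx), Pi.zero_apply] at h
  linarith [le_max_left (w x - u x) 0]

/-! ### Infinite interaction at the boundary point forces the barrier bound -/

/-- The essential bound on the negative part holds at every point, because `u` is continuous. -/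
lemma exists_lower_bound {N : ℕ} {Ω : Set (EuclideanSpace ℝ (Fin N))} (hΩ : IsOpen Ω)
    {u : EuclideanSpace ℝ (Fin N) → ℝ} (hu : Continuous u) (hz : ∀ x, x ∉ Ω → u x = 0)
    (hneg : MemLp (fun x => max (-u x) 0) ⊤ (volume.restrict Ω)) :
    ∃ L, 0 ≤ L ∧ ∀ x, -L ≤ u x := by
  set L := (eLpNorm (fun x => max (-u x) 0) ⊤ (volume.restrict Ω)).toReal with hL
  refine ⟨L, ENNReal.toReal_nonneg, fun x => ?_⟩
  by_contra hx
  rw [not_le] at hx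
  have hL0 : 0 ≤ L := ENNReal.toReal_nonneg
  have hop : IsOpen (Ω ∩ {x | u x < -L}) := hΩ.inter (isOpen_lt hu continuous_const)
  have hxΩ : x ∈ Ω := by
    by_contra h
    rw [hz x h] at hx; linarith
  have hpos := hop.measure_pos volume ⟨x, hxΩ, hx⟩
  refine hpos.ne' ?_
  have hae := ae_le_eLpNormEssSup (μ := volume.restrict Ω) (f := fun x => max (-u x) 0)
  rw [ae_restrict_iff' hΩ.measurableSet, ae_iff] at hae
  refine measure_mono_null (fun x' hx' => ?_) hae
  have h1 : L < max (-u x') 0 := lt_max_of_lt_left (by linarith [hx'.2.out])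
  intro h
  have h2 := h hx'.1
  rw [← eLpNorm_exponent_top, ← ENNReal.ofReal_toReal hneg.2.ne, ← hL,
    Real.enorm_of_nonneg (le_max_right _ _), ENNReal.ofReal_le_ofReal_iff hL0] at h2
  linarith

lemma ae_abs_le_of_memLp_top {X : Type*} [MeasurableSpace X] {μ : Measure X} {c : X → ℝ}
    (hc : MemLp c ⊤ μ) : ∀ᵐ x ∂μ, |c x| ≤ (eLpNorm c ⊤ μ).toReal := by
  filter_upwards [ae_le_eLpNormEssSup (μ := μ) (f := c)] with x hx
  rw [← eLpNorm_exponent_top, ← ENNReal.ofReal_toReal hc.2.ne, Real.enorm_eq_ofReal_abs,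
    ENNReal.ofReal_le_ofReal_iff ENNReal.toReal_nonneg] at hx
  exact hx

/-- Seen from a point `x'` much farther away, `x` and `x₀` are at comparable distances. -/
lemma kernel_comparable {N : ℕ} {e : ℝ} (he : 0 ≤ e) {x x' x₀ : EuclideanSpace ℝ (Fin N)}
    (h : 2 * ‖x - x₀‖ ≤ ‖x' - x₀‖) (h0 : 0 < ‖x' - x₀‖) :
    (2 ^ e)⁻¹ * (‖x' - x₀‖ ^ e)⁻¹ ≤ (‖x - x'‖ ^ e)⁻¹ ∧
      (‖x - x'‖ ^ e)⁻¹ ≤ 2 ^ e * (‖x' - x₀‖ ^ e)⁻¹ := by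
  have h1 : ‖x - x'‖ ≤ 2 * ‖x' - x₀‖ := by
    have := norm_sub_le (x - x₀) (x' - x₀)
    rw [sub_sub_sub_cancel_right] at this
    linarith
  have h2 : ‖x' - x₀‖ / 2 ≤ ‖x - x'‖ := by
    have := norm_sub_norm_le (x' - x₀) (x - x₀)
    rw [sub_sub_sub_cancel_right, norm_sub_rev x' x] at this
    linarith
  have h3 : 0 < ‖x - x'‖ := by linarith
  constructor
  · rw [← mul_inv, ← Real.mul_rpow zero_le_two h0.le]
    gcongr
  · rw [show (2 : ℝ) ^ e * (‖x' - x₀‖ ^ e)⁻¹ = ((‖x' - x₀‖ / 2) ^ e)⁻¹ by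
      rw [Real.div_rpow h0.le zero_le_two, inv_div, div_eq_mul_inv]]
    gcongr

lemma truncKernel_of_lt {N : ℕ} {s ε : ℝ} {z : EuclideanSpace ℝ (Fin N)} (h : ε < ‖z‖) :
    truncKernel s ε z = (‖z‖ ^ ((N : ℝ) + 2 * s))⁻¹ :=
  indicator_of_mem (show z ∈ {z | ε < ‖z‖} from h) _

lemma truncKernel_of_le {N : ℕ} {s ε : ℝ} {z : EuclideanSpace ℝ (Fin N)} (h : ‖z‖ ≤ ε) :
    truncKernel s ε z = 0 :=
  indicator_of_notMem (show z ∉ {z | ε < ‖z‖} from not_lt.2 h) _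

/-- If the interaction of `u` with the point `x₀` is infinite, its part at distance more than `τ`
is arbitrarily large for small `τ`. -/
lemma exists_trunc_interaction_gt {N : ℕ} {s δ : ℝ} (hs : 0 < s) (hδ : 0 < δ)
    {u : EuclideanSpace ℝ (Fin N) → ℝ} (hu : Measurable u) {x₀ : EuclideanSpace ℝ (Fin N)}
    (hu0 : ∀ x ∈ ball x₀ δ, 0 ≤ u x)
    (hmass : ∫⁻ x in ball x₀ δ, ENNReal.ofReal (u x / ‖x - x₀‖ ^ ((N : ℝ) + 2 * s)) = ⊤) (M : ℝ) :
    ∃ τ, 0 < τ ∧ τ < δ / 2 ∧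
      ENNReal.ofReal M < ∫⁻ x in ball x₀ δ, ENNReal.ofReal (u x * truncKernel s τ (x - x₀)) := by
  have ht : Tendsto (fun n : ℕ => ∫⁻ x in ball x₀ δ,
      ENNReal.ofReal (u x * truncKernel s (1 / ((n : ℝ) + 1)) (x - x₀))) atTop (𝓝 ⊤) := by
    rw [← hmass]
    refine lintegral_tendsto_of_tendsto_of_monotone (fun n => by fun_prop) ?_
      (ae_of_all _ fun x => ?_)
    · filter_upwards [ae_restrict_mem measurableSet_ball] with x hx m n hmn
      refine ENNReal.ofReal_le_ofReal (mul_le_mul_of_nonneg_left ?_ (hu0 x hx))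
      unfold truncKernel
      refine indicator_le_indicator_of_subset (fun z (hz : _ < ‖z‖) => ?_)
        (fun _ => by positivity) _
      exact (one_div_le_one_div_of_le (by positivity) (by gcongr)).trans_lt hz
    · refine (ENNReal.continuous_ofReal.tendsto _).comp (tendsto_nhds_of_eventually_eq ?_)
      by_cases hx : x = x₀
      · refine Eventually.of_forall fun n => ?_
        rw [truncKernel_of_le (by simpa [hx] using by positivity), hx, sub_self, norm_zero,
          Real.zero_rpow (by positivity), mul_zero, div_zero]
      · filter_upwards [truncKernel_eventually s (sub_ne_zero.2 hx)] with n hn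
        rw [hn, div_eq_mul_inv]
  have h2 := (tendsto_one_div_add_atTop_nhds_zero_nat (𝕜 := ℝ)).eventually
    (gt_mem_nhds (half_pos hδ))
  obtain ⟨n, hn1, hn2⟩ := ((ht.eventually (lt_mem_nhds ENNReal.ofReal_lt_top)).and h2).exists
  exact ⟨_, by positivity, hn2, hn1⟩

/-- If `∫ u(x) |x - x₀|^(-N-2s) dx` diverges near `x₀`, then `u` lies above the barrier in every
small ball in `Ω` that touches `x₀`. -/
lemma barrier_le_of_infinite_interaction {N : ℕ} (hN : 1 ≤ N) {s : ℝ} (hs0 : 0 < s) (hs1 : s < 1)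
    {Ω : Set (EuclideanSpace ℝ (Fin N))} (hΩ : IsOpen Ω) {c u : EuclideanSpace ℝ (Fin N) → ℝ}
    (hc : MemLp c ⊤ (volume.restrict Ω)) (hu : Continuous u) (hsup : IsSupersolution s Ω c u)
    (hneg : MemLp (fun x => max (-u x) 0) ⊤ (volume.restrict Ω)) {x₀ : EuclideanSpace ℝ (Fin N)}
    {δ : ℝ} (hδ : 0 < δ) (hu0 : ∀ x ∈ ball x₀ δ, 0 ≤ u x)
    (hmass : ∫⁻ x in ball x₀ δ, ENNReal.ofReal (u x / ‖x - x₀‖ ^ ((N : ℝ) + 2 * s)) = ⊤) :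
    ∃ ρ₀, 0 < ρ₀ ∧ ∀ ρ, 0 < ρ → ρ < ρ₀ → ∀ y : EuclideanSpace ℝ (Fin N), ball y ρ ⊆ Ω →
      x₀ ∈ sphere y ρ → ∀ x ∈ ball y ρ, barrier s ρ y x ≤ u x := by
  obtain ⟨L, hL0, hL⟩ := exists_lower_bound hΩ hu hsup.2.1 hneg
  obtain ⟨C, hC0, hC⟩ : ∃ C : ℝ, 0 ≤ C ∧ ∀ᵐ x ∂(volume.restrict Ω), |c x| ≤ C :=
    ⟨_, ENNReal.toReal_nonneg, ae_abs_le_of_memLp_top hc⟩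
  obtain ⟨U, hU⟩ := (isCompact_closedBall x₀ δ).exists_bound_of_continuousOn hu.continuousOn
  have hU0 : 0 ≤ U := (norm_nonneg _).trans (hU x₀ (mem_closedBall_self hδ.le))
  set e : ℝ := (N : ℝ) + 2 * s with he
  have he0 : 0 ≤ e := by positivity
  have h2e : (0 : ℝ) < 2 ^ e := by positivity
  have hKi : ∀ {τ : ℝ}, 0 < τ → Integrable fun x' : EuclideanSpace ℝ (Fin N) =>
      truncKernel s τ (x' - x₀) := fun hτ => (integrable_truncKernel hs0 hτ).comp_sub_right x₀
  set B : ℝ := 2 ^ e * L * ∫ x', truncKernel s (δ / 2) (x' - x₀) with hB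
  set m : ℝ := barrierConst N s + C / 2 + 1 with hm
  obtain ⟨τ, hτ0, hτδ, hτ⟩ :=
    exists_trunc_interaction_gt hs0 hδ hu.measurable hu0 hmass (2 ^ e * (m + B))
  set I : ℝ := ∫ x in ball x₀ δ, u x * truncKernel s τ (x - x₀) with hI
  have hIi : IntegrableOn (fun x => u x * truncKernel s τ (x - x₀)) (ball x₀ δ) := by
    refine (hKi hτ0).integrableOn.bdd_mul (c := U) (by fun_prop) ?_
    filter_upwards [ae_restrict_mem measurableSet_ball] with x hx
    exact hU x (ball_subset_closedBall hx)
  have hIgt : 2 ^ e * (m + B) < I := by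
    rw [← ofReal_integral_eq_lintegral_ofReal hIi] at hτ
    · exact lt_of_not_ge fun h => absurd hτ (not_lt.2 (ENNReal.ofReal_le_ofReal h))
    · filter_upwards [ae_restrict_mem measurableSet_ball] with x hx
      exact mul_nonneg (hu0 x hx) (truncKernel_nonneg _ _ _)
  -- `k` is `u` on the annulus `τ < |x - x₀| < δ` and the lower bound `-L` outside `B_δ(x₀)`;
  -- `B` bounds the interaction of the latter part with a point near `x₀`.
  set k : EuclideanSpace ℝ (Fin N) → ℝ := fun x =>
    if ‖x - x₀‖ < δ then (if τ < ‖x - x₀‖ then u x else 0) else -L with hk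
  have hkm : Measurable k :=
    Measurable.ite (measurableSet_lt (by fun_prop) measurable_const)
      (Measurable.ite (measurableSet_lt measurable_const (by fun_prop)) hu.measurable
        measurable_const) measurable_const
  have hkb : ∀ x, |k x| ≤ U + L := by
    intro x
    simp only [hk]
    split_ifs with h1 h2
    · have := hU x (by rw [mem_closedBall, dist_eq_norm]; exact h1.le)
      rw [Real.norm_eq_abs] at this
      linarith
    · simpa using add_nonneg hU0 hL0
    · rw [abs_neg, abs_of_nonneg hL0]; linarith
  have hkz : ∀ x, ‖x - x₀‖ ≤ τ → k x = 0 := by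
    intro x hx
    simp only [hk]
    rw [if_pos (by linarith), if_neg (not_lt.2 hx)]
  refine ⟨min 1 (τ / 4), by positivity, fun ρ hρ hρ' y hball hx₀ => ?_⟩
  have hρ1 : ρ < 1 := hρ'.trans_le (min_le_left _ _)
  have hρτ : ρ < τ / 4 := hρ'.trans_le (min_le_right _ _)
  have hnear : ∀ x ∈ ball y ρ, ‖x - x₀‖ < τ / 2 := by
    intro x hx
    rw [← dist_eq_norm]
    rw [mem_ball] at hx
    rw [mem_sphere] at hx₀
    linarith [dist_triangle_right x x₀ y]
  have hsmall : ∀ x ∈ ball y ρ, x ∈ ball x₀ δ := fun x hx => by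
    rw [mem_ball, dist_eq_norm]; linarith [hnear x hx]
  -- the kernel seen from a point of the small ball, against the kernel seen from `x₀`
  have hcomp : ∀ x ∈ ball y ρ, ∀ x', τ < ‖x' - x₀‖ →
      (2 ^ e)⁻¹ * (‖x' - x₀‖ ^ e)⁻¹ ≤ (‖x - x'‖ ^ e)⁻¹ ∧
      (‖x - x'‖ ^ e)⁻¹ ≤ 2 ^ e * (‖x' - x₀‖ ^ e)⁻¹ := fun x hx x' hx' =>
    kernel_comparable he0 (by linarith [hnear x hx]) (hτ0.trans hx')
  set G : EuclideanSpace ℝ (Fin N) → ℝ := fun x' =>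
    (U + L) * 2 ^ e * truncKernel s τ (x' - x₀) with hG
  have hGi : Integrable G := (hKi hτ0).const_mul _
  have hkG : ∀ x ∈ ball y ρ, ∀ x', |k x'| / ‖x - x'‖ ^ e ≤ G x' := by
    intro x hx x'
    rcases le_or_gt ‖x' - x₀‖ τ with h | h
    · rw [hkz x' h, abs_zero, zero_div]
      exact mul_nonneg (by positivity) (truncKernel_nonneg _ _ _)
    · simp only [hG]
      rw [truncKernel_of_lt h, div_eq_mul_inv, mul_assoc]
      exact mul_le_mul (hkb x') (hcomp x hx x' h).2 (by positivity) (by positivity)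
  refine barrier_le_of_interaction hN hs0 hs1 hΩ hC0 hC hu hsup hρ hρ1.le hball
    (fun x hx => hu0 x (hsmall x hx)) hkm (fun x hx => hkz x (by linarith [hnear x hx]))
    (fun x _ => ?_) hGi hkG (m := m) (fun x hx => ?_) (by rw [hm]; linarith)
  · simp only [hk]
    split_ifs with h1 h2
    · exact le_rfl
    · exact hu0 x (by rwa [mem_ball, dist_eq_norm])
    · exact hL x
  · have hki : Integrable fun x' => k x' / ‖x - x'‖ ^ e := by
      refine hGi.mono' (hkm.div (by fun_prop)).aestronglyMeasurable (ae_of_all _ fun x' => ?_)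
      rw [norm_div, Real.norm_eq_abs, Real.norm_of_nonneg (by positivity)]
      exact hkG x hx x'
    have hlow : Integrable fun x' => (2 ^ e)⁻¹ * (ball x₀ δ).indicator
        (fun x' => u x' * truncKernel s τ (x' - x₀)) x' -
        2 ^ e * L * truncKernel s (δ / 2) (x' - x₀) :=
      ((integrable_indicator_iff measurableSet_ball).2 hIi |>.const_mul _).sub
        ((hKi (half_pos hδ)).const_mul _)
    calc m ≤ (2 ^ e)⁻¹ * I - B := by
          have : m + B ≤ (2 ^ e)⁻¹ * I := by
            rw [inv_mul_eq_div, le_div_iff₀ h2e, mul_comm]; exact hIgt.le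
          linarith
      _ = ∫ x', ((2 ^ e)⁻¹ * (ball x₀ δ).indicator
          (fun x' => u x' * truncKernel s τ (x' - x₀)) x' -
          2 ^ e * L * truncKernel s (δ / 2) (x' - x₀)) := by
          rw [integral_sub ((integrable_indicator_iff measurableSet_ball).2 hIi |>.const_mul _)
            ((hKi (half_pos hδ)).const_mul _), integral_const_mul, integral_const_mul,
            integral_indicator measurableSet_ball]
      _ ≤ ∫ x', k x' / ‖x - x'‖ ^ e := by
          refine integral_mono hlow hki fun x' => ?_
          simp only
          have hnn : 0 ≤ 2 ^ e * L * truncKernel s (δ / 2) (x' - x₀) :=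
            mul_nonneg (by positivity) (truncKernel_nonneg _ _ _)
          by_cases hδ' : ‖x' - x₀‖ < δ
          · have hx'b : x' ∈ ball x₀ δ := by rwa [mem_ball, dist_eq_norm]
            rw [indicator_of_mem hx'b]
            rcases le_or_gt ‖x' - x₀‖ τ with h | h
            · rw [hkz x' h, truncKernel_of_le h, mul_zero, mul_zero, zero_div, zero_sub]
              linarith
            · have hkx : k x' = u x' := by simp only [hk]; rw [if_pos hδ', if_pos h]
              rw [hkx, truncKernel_of_lt h, ← he, div_eq_mul_inv (u x')]
              have := mul_le_mul_of_nonneg_left (hcomp x hx x' h).1 (hu0 x' hx'b)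
              linarith
          · have hkx : k x' = -L := by simp only [hk]; rw [if_neg hδ']
            rw [indicator_of_notMem (by rwa [mem_ball, dist_eq_norm]), mul_zero, zero_sub, hkx,
              truncKernel_of_lt (by linarith), div_eq_mul_inv, neg_mul]
            have := mul_le_mul_of_nonneg_left (hcomp x hx x' (by linarith)).2 hL0
            linarith

/-! ### The two growth conditions and the interaction at the boundary point -/

/-- If, at arbitrarily small scales `r`, the function is at least `κ r^(2s)` on a ball of radius
`r / 4` contained in `B_{2r}(x₀)`, then its interaction with `x₀` is infinite: every such
scale contributes at least a fixed amount. -/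
lemma interaction_eq_top {N : ℕ} (hN : 1 ≤ N) {s δ κ : ℝ} (hs : 0 < s) (hδ : 0 < δ) (hκ : 0 < κ)
    {u : EuclideanSpace ℝ (Fin N) → ℝ} {x₀ : EuclideanSpace ℝ (Fin N)} (hx₀ : u x₀ = 0)
    (h : ∃ᶠ r in 𝓝[>] (0 : ℝ), ∃ y, ball y (r / 4) ⊆ ball x₀ (2 * r) ∧
      ∀ x ∈ ball y (r / 4), κ * r ^ (2 * s) ≤ u x) :
    ∫⁻ x in ball x₀ δ, ENNReal.ofReal (u x / ‖x - x₀‖ ^ ((N : ℝ) + 2 * s)) = ⊤ := by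
  by_contra hfin
  have hr2 : Tendsto (fun r : ℝ => 2 * r) (𝓝[>] 0) (𝓝 0) := by
    have : Tendsto (fun r : ℝ => 2 * r) (𝓝 0) (𝓝 (2 * 0)) := tendsto_id.const_mul 2
    rw [mul_zero] at this
    exact this.mono_left nhdsWithin_le_nhds
  have hball : Tendsto (volume.restrict (ball x₀ δ) ∘ fun r : ℝ => ball x₀ (2 * r)) (𝓝[>] 0)
      (𝓝 0) := by
    have hv : Tendsto (fun r : ℝ => ENNReal.ofReal ((2 * r) ^ N) *
        volume (ball (0 : EuclideanSpace ℝ (Fin N)) 1)) (𝓝[>] 0) (𝓝 0) := by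
      have h1 : Tendsto (fun r : ℝ => ENNReal.ofReal ((2 * r) ^ N)) (𝓝[>] 0) (𝓝 0) := by
        have := ENNReal.tendsto_ofReal (hr2.pow N)
        rwa [zero_pow (by omega), ENNReal.ofReal_zero] at this
      simpa using ENNReal.Tendsto.mul_const h1 (Or.inr measure_ball_lt_top.ne)
    refine tendsto_of_tendsto_of_tendsto_of_le_of_le' tendsto_const_nhds hv
      (Eventually.of_forall fun r => zero_le) ?_
    filter_upwards [self_mem_nhdsWithin] with r hr
    have hr' : 0 < r := hr
    refine (Measure.restrict_apply_le _ _).trans_eq ?_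
    rw [Measure.addHaar_ball_of_pos _ _ (by positivity), finrank_euclideanSpace, Fintype.card_fin]
  have ht := tendsto_setLIntegral_zero hfin hball
  set c₀ : ℝ≥0∞ := ENNReal.ofReal (κ / (2 ^ ((N : ℝ) + 2 * s) * 4 ^ N)) *
    volume (ball (0 : EuclideanSpace ℝ (Fin N)) 1) with hc₀
  have hc₀pos : 0 < c₀ := by
    refine ENNReal.mul_pos (ENNReal.ofReal_pos.2 (by positivity)).ne' ?_
    exact (measure_ball_pos _ _ one_pos).ne'
  obtain ⟨r, ⟨y, hy1, hy2⟩, ⟨hr, hrδ⟩, hlt⟩ := (h.and_eventually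
    (((eventually_mem_nhdsWithin (a := (0 : ℝ)) (s := Ioi 0)).and
      (hr2.eventually (gt_mem_nhds hδ))).and
      (ht.eventually (gt_mem_nhds hc₀pos)))).exists
  have hr0 : 0 < r := hr
  refine absurd hlt (not_lt.2 ?_)
  rw [Measure.restrict_restrict measurableSet_ball,
    inter_eq_self_of_subset_left (ball_subset_ball hrδ.le)]
  calc c₀ = ∫⁻ x in ball y (r / 4),
        ENNReal.ofReal (κ * r ^ (2 * s) / (2 * r) ^ ((N : ℝ) + 2 * s)) := by
        rw [setLIntegral_const, Measure.addHaar_ball_of_pos _ _ (by positivity),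
          finrank_euclideanSpace, Fintype.card_fin, ← mul_assoc,
          ← ENNReal.ofReal_mul (by positivity), hc₀]
        congr 2
        rw [Real.mul_rpow zero_le_two hr0.le, Real.rpow_add hr0, Real.rpow_natCast, div_pow]
        field_simp
    _ ≤ ∫⁻ x in ball y (r / 4), ENNReal.ofReal (u x / ‖x - x₀‖ ^ ((N : ℝ) + 2 * s)) := by
        refine setLIntegral_mono' measurableSet_ball fun x hx => ENNReal.ofReal_le_ofReal ?_
        have hux := hy2 x hx
        have hpos : 0 < u x := lt_of_lt_of_le (by positivity) hux
        have hne : 0 < ‖x - x₀‖ := by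
          rw [norm_pos_iff, sub_ne_zero]
          rintro rfl
          exact hpos.ne' hx₀
        have hle : ‖x - x₀‖ ≤ 2 * r := by
          have := hy1 hx
          rw [mem_ball, dist_eq_norm] at this
          exact this.le
        gcongr
    _ ≤ _ := lintegral_mono_set hy1

/-- The ball of radius `r / 4` is taken concentric with `B_{r/2}(z_r)`. -/
lemma interaction_eq_top_of_fastGrowth {N : ℕ} (hN : 1 ≤ N) {s δ : ℝ} (hs : 0 < s) (hδ : 0 < δ)
    {Ω : Set (EuclideanSpace ℝ (Fin N))} {u : EuclideanSpace ℝ (Fin N) → ℝ}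
    {x₀ : EuclideanSpace ℝ (Fin N)} (hx₀ : u x₀ = 0) (hu0 : ∀ x ∈ ball x₀ δ, 0 ≤ u x)
    {z : ℝ → EuclideanSpace ℝ (Fin N)}
    (hz : ∀ᶠ r in 𝓝[>] (0 : ℝ), ball (z r) r ⊆ Ω ∧ x₀ ∈ sphere (z r) r) (hF : FastGrowth s z u) :
    ∫⁻ x in ball x₀ δ, ENNReal.ofReal (u x / ‖x - x₀‖ ^ ((N : ℝ) + 2 * s)) = ⊤ := by
  obtain ⟨b, hb0, hb⟩ := EReal.lt_iff_exists_real_btwn.1 hF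
  have hb0' : 0 < b := by exact_mod_cast hb0
  have hsmall : ∀ᶠ r in 𝓝[>] (0 : ℝ), r < δ / 2 := nhdsWithin_le_nhds (gt_mem_nhds (half_pos hδ))
  refine interaction_eq_top hN hs hδ hb0' hx₀ (((frequently_lt_of_lt_limsup (by isBoundedDefault)
    hb).and_eventually ((hz.and hsmall).and self_mem_nhdsWithin)).mono ?_)
  rintro r ⟨hbr, ⟨⟨hzr1, hzr2⟩, hrδ⟩, hr⟩
  have hr0 : 0 < r := hr
  rw [mem_sphere] at hzr2
  have hbr' : b < 1 / r ^ (2 * s) * sInf ((fun x => |u x|) '' ball (z r) (r / 2)) := by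
    exact_mod_cast hbr
  rw [one_div_mul_eq_div, lt_div_iff₀ (by positivity)] at hbr'
  refine ⟨z r, fun x hx => ?_, fun x hx => ?_⟩
  · rw [mem_ball] at hx ⊢
    linarith [dist_triangle x (z r) x₀, dist_comm x₀ (z r)]
  · rw [mem_ball] at hx
    have h1 : sInf ((fun x => |u x|) '' ball (z r) (r / 2)) ≤ |u x| :=
      csInf_le ⟨0, by rintro _ ⟨x, -, rfl⟩; exact abs_nonneg _⟩
        (mem_image_of_mem _ (by rw [mem_ball]; linarith))
    rw [abs_of_nonneg (hu0 x (by
      rw [mem_ball]; linarith [dist_triangle x (z r) x₀, dist_comm x₀ (z r)]))] at h1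
    linarith

/-- The ball of radius `r / 4` is centred on the axis of the cone of half-opening `π / 3`, at
distance `r` from the vertex. On it `u ≥ b |x - x₀|ˢ ≥ b (r / 2)ˢ`, which for `r ≤ 1` is at least a
multiple of `r^(2s)`. -/
lemma interaction_eq_top_of_satisfiesHopf {N : ℕ} (hN : 1 ≤ N) {s δ : ℝ} (hs : 0 < s) (hδ : 0 < δ)
    {Ω : Set (EuclideanSpace ℝ (Fin N))} {u : EuclideanSpace ℝ (Fin N) → ℝ}
    {x₀ y₀ : EuclideanSpace ℝ (Fin N)} (hx₀ : u x₀ = 0) {R : ℝ} (hR : 0 < R)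
    (hball : ball y₀ R ⊆ Ω) (hx₀y₀ : x₀ ∈ sphere y₀ R) (hH : SatisfiesHopf s Ω x₀ y₀ u) :
    ∫⁻ x in ball x₀ δ, ENNReal.ofReal (u x / ‖x - x₀‖ ^ ((N : ℝ) + 2 * s)) = ⊤ := by
  have hpi := Real.pi_pos
  obtain ⟨b, hb0, hb⟩ := EReal.lt_iff_exists_real_btwn.1
    (hH (Real.pi / 3) (by positivity) (by linarith))
  have hb0' : 0 < b := by exact_mod_cast hb0
  have hev := eventually_lt_of_lt_liminf hb
  rw [eventually_nhdsWithin_iff, Metric.eventually_nhds_iff] at hev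
  obtain ⟨η, hη, hev⟩ := hev
  have hRn : ‖y₀ - x₀‖ = R := by rw [← dist_eq_norm, dist_comm]; exact hx₀y₀
  have hsmall : ∀ᶠ r in 𝓝[>] (0 : ℝ), r < min (min 1 (η / 2)) R :=
    nhdsWithin_le_nhds (gt_mem_nhds (by positivity))
  refine interaction_eq_top hN hs hδ (κ := b * (1 / 2) ^ s) (by positivity) hx₀
    (Eventually.frequently ?_)
  filter_upwards [hsmall, self_mem_nhdsWithin] with r hr hr'
  have hr0 : 0 < r := hr'
  rw [lt_min_iff, lt_min_iff] at hr
  obtain ⟨⟨hr1, hrη⟩, hrR⟩ := hr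
  set v : EuclideanSpace ℝ (Fin N) := (r / R) • (y₀ - x₀) with hv
  have hvn : ‖v‖ = r := by
    rw [hv, norm_smul, hRn, Real.norm_of_nonneg (by positivity)]; field_simp
  have hdist : ∀ x ∈ ball (x₀ + v) (r / 4), ‖(x - x₀) - v‖ < r / 4 := fun x hx => by
    rwa [mem_ball, dist_eq_norm, ← sub_sub] at hx
  have hup : ∀ x ∈ ball (x₀ + v) (r / 4), ‖x - x₀‖ < 5 / 4 * r := fun x hx => by
    have := norm_sub_norm_le (x - x₀) v
    linarith [hdist x hx]
  have hlo : ∀ x ∈ ball (x₀ + v) (r / 4), r / 2 < ‖x - x₀‖ := fun x hx => by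
    have := norm_sub_norm_le v (x - x₀)
    rw [norm_sub_rev v (x - x₀)] at this
    linarith [hdist x hx]
  refine ⟨x₀ + v, fun x hx => ?_, fun x hx => ?_⟩
  · rw [mem_ball, dist_eq_norm]; linarith [hup x hx]
  · have hxΩ : x ∈ Ω := by
      refine hball ?_
      have e : x - y₀ = ((x - x₀) - v) + (-(1 - r / R)) • (y₀ - x₀) := by
        rw [hv]; module
      have h1 : ‖(-(1 - r / R)) • (y₀ - x₀)‖ = R - r := by
        rw [norm_smul, hRn, norm_neg, Real.norm_of_nonneg
          (sub_nonneg.2 ((div_le_one hR).2 hrR.le))]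
        field_simp
      rw [mem_ball, dist_eq_norm, e]
      have := norm_add_le ((x - x₀) - v) ((-(1 - r / R)) • (y₀ - x₀))
      linarith [hdist x hx]
    -- The cosine of the angle is at least `(3 / 4) / (5 / 4) > 1 / 2`.
    have hangle : InnerProductGeometry.angle (x - x₀) (y₀ - x₀) < Real.pi / 3 := by
      by_contra hcon
      rw [not_lt] at hcon
      have h1 := Real.cos_le_cos_of_nonneg_of_le_pi (by positivity)
        (InnerProductGeometry.angle_le_pi (x - x₀) (y₀ - x₀)) hcon
      rw [Real.cos_pi_div_three] at h1
      have h2 := InnerProductGeometry.cos_angle_mul_norm_mul_norm (x - x₀) (y₀ - x₀)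
      have h3 : inner ℝ (x - x₀) (y₀ - x₀) =
          inner ℝ ((x - x₀) - v) (y₀ - x₀) + r * R := by
        rw [inner_sub_left (x - x₀) v, hv, inner_smul_left, real_inner_self_eq_norm_sq, hRn]
        simp only [conj_trivial]
        field_simp
        ring
      have h4 := neg_abs_le (inner ℝ ((x - x₀) - v) (y₀ - x₀))
      have h5 := abs_real_inner_le_norm ((x - x₀) - v) (y₀ - x₀)
      rw [hRn] at h2 h5
      have h6 : ‖(x - x₀) - v‖ * R ≤ r / 4 * R := by gcongr; exact (hdist x hx).le
      have h7 : Real.cos (InnerProductGeometry.angle (x - x₀) (y₀ - x₀)) * (‖x - x₀‖ * R) ≤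
          1 / 2 * (5 / 4 * r * R) := by
        gcongr
        exact (hup x hx).le
      nlinarith [mul_pos hr0 hR]
    have h1 := hev (y := x) (by rw [dist_eq_norm]; linarith [hup x hx]) ⟨hxΩ, hangle⟩
    have h2 : b < u x / ‖x - x₀‖ ^ s := by exact_mod_cast h1
    have h3 : 0 < ‖x - x₀‖ := by linarith [hlo x hx]
    rw [lt_div_iff₀ (by positivity)] at h2
    refine le_trans ?_ h2.le
    rw [mul_assoc]
    refine mul_le_mul_of_nonneg_left ?_ hb0'.le
    calc (1 / 2 : ℝ) ^ s * r ^ (2 * s) ≤ (1 / 2 : ℝ) ^ s * r ^ s := by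
          refine mul_le_mul_of_nonneg_left ?_ (by positivity)
          exact Real.rpow_le_rpow_of_exponent_ge hr0 hr1.le (by linarith)
      _ = (r / 2) ^ s := by
          rw [← Real.mul_rpow (by norm_num) hr0.le]; congr 1; ring
      _ ≤ ‖x - x₀‖ ^ s := Real.rpow_le_rpow (by positivity) (hlo x hx).le hs.le

/-- A lower bound by the barriers of all small touching balls gives growth of order `r^(2s)`: at
half the radius, the barrier is at least `(3 r² / 4)ˢ`. -/
lemma fastGrowth_of_barrier_le {N : ℕ} {s : ℝ} (hs : 0 < s)
    {Ω : Set (EuclideanSpace ℝ (Fin N))} {u : EuclideanSpace ℝ (Fin N) → ℝ}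
    {x₀ : EuclideanSpace ℝ (Fin N)} {ρ₀ : ℝ} (hρ₀ : 0 < ρ₀)
    (hb : ∀ ρ, 0 < ρ → ρ < ρ₀ → ∀ y : EuclideanSpace ℝ (Fin N), ball y ρ ⊆ Ω →
      x₀ ∈ sphere y ρ → ∀ x ∈ ball y ρ, barrier s ρ y x ≤ u x)
    {z : ℝ → EuclideanSpace ℝ (Fin N)}
    (hz : ∀ᶠ r in 𝓝[>] (0 : ℝ), ball (z r) r ⊆ Ω ∧ x₀ ∈ sphere (z r) r) : FastGrowth s z u := by
  have hκ : (0 : ℝ) < (3 / 4) ^ s := by positivity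
  refine lt_of_lt_of_le (b := (((3 / 4) ^ s : ℝ) : EReal)) (by exact_mod_cast hκ) ?_
  refine le_trans ?_ (liminf_le_limsup (by isBoundedDefault) (by isBoundedDefault))
  refine le_liminf_of_le (by isBoundedDefault) ?_
  filter_upwards [hz, self_mem_nhdsWithin, nhdsWithin_le_nhds (gt_mem_nhds hρ₀)]
    with r ⟨h1, h2⟩ hr hrρ
  have hr0 : 0 < r := hr
  rw [EReal.coe_le_coe_iff, one_div_mul_eq_div, le_div_iff₀ (by positivity)]
  refine le_csInf ((nonempty_ball.2 (half_pos hr0)).image _) ?_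
  rintro _ ⟨x, hx, rfl⟩
  refine le_trans ?_ (le_abs_self _)
  have hx' : ‖x - z r‖ < r / 2 := by rwa [mem_ball, dist_eq_norm] at hx
  refine le_trans ?_ (hb r hr0 hrρ (z r) h1 h2 x (ball_subset_ball (by linarith) hx))
  rw [Real.rpow_mul hr0.le, ← Real.mul_rpow (by norm_num) (by positivity), barrier]
  refine Real.rpow_le_rpow (by positivity) (le_max_of_le_left ?_) hs.le
  rw [Real.rpow_two]
  nlinarith [norm_nonneg (x - z r)]

/-- A lower bound by the barrier of a small ball inside the interior ball gives Hopf's Lemma: inside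
a cone, the barrier grows like the `s`-th power of the distance to the vertex. -/
lemma satisfiesHopf_of_barrier_le {N : ℕ} {s : ℝ} (hs : 0 < s)
    {Ω : Set (EuclideanSpace ℝ (Fin N))} {u : EuclideanSpace ℝ (Fin N) → ℝ}
    {x₀ y₀ : EuclideanSpace ℝ (Fin N)} (hx₀ : x₀ ∉ Ω) {R : ℝ} (hR : 0 < R)
    (hball : ball y₀ R ⊆ Ω) (hx₀y₀ : x₀ ∈ sphere y₀ R) {ρ₀ : ℝ} (hρ₀ : 0 < ρ₀)
    (hb : ∀ ρ, 0 < ρ → ρ < ρ₀ → ∀ y : EuclideanSpace ℝ (Fin N), ball y ρ ⊆ Ω →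
      x₀ ∈ sphere y ρ → ∀ x ∈ ball y ρ, barrier s ρ y x ≤ u x) : SatisfiesHopf s Ω x₀ y₀ u := by
  intro β hβ0 hβ
  have hRn : ‖y₀ - x₀‖ = R := by rw [← dist_eq_norm, dist_comm]; exact hx₀y₀
  obtain ⟨ρ, hρ, hρ'⟩ := exists_between (lt_min hρ₀ hR)
  rw [lt_min_iff] at hρ'
  have hcos : 0 < Real.cos β := Real.cos_pos_of_mem_Ioo ⟨by linarith, hβ⟩
  set v : EuclideanSpace ℝ (Fin N) := (ρ / R) • (y₀ - x₀) with hv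
  have hvn : ‖v‖ = ρ := by
    rw [hv, norm_smul, hRn, Real.norm_of_nonneg (by positivity)]; field_simp
  have hsub : ball (x₀ + v) ρ ⊆ Ω := by
    refine (ball_subset_ball' ?_).trans hball
    have e : x₀ + v - y₀ = (-(1 - ρ / R)) • (y₀ - x₀) := by rw [hv]; module
    rw [dist_eq_norm, e, norm_smul, hRn, norm_neg, Real.norm_of_nonneg
      (sub_nonneg.2 ((div_le_one hR).2 hρ'.2.le))]
    exact le_of_eq (by field_simp; ring)
  have hmem : x₀ ∈ sphere (x₀ + v) ρ := by
    rw [mem_sphere, dist_eq_norm, sub_add_cancel_left, norm_neg, hvn]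
  have hκ : (0 : ℝ) < (ρ * Real.cos β) ^ s := by positivity
  refine lt_of_lt_of_le (b := (((ρ * Real.cos β) ^ s : ℝ) : EReal)) (by exact_mod_cast hκ) ?_
  refine le_liminf_of_le (by isBoundedDefault) ?_
  filter_upwards [self_mem_nhdsWithin, nhdsWithin_le_nhds (ball_mem_nhds x₀ (mul_pos hρ hcos))]
    with x ⟨hxΩ, hxβ⟩ hx
  rw [mem_ball, dist_eq_norm] at hx
  have ht : 0 < ‖x - x₀‖ := by
    rw [norm_pos_iff, sub_ne_zero]
    rintro rfl
    exact hx₀ hxΩ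
  have h1 : Real.cos β ≤ Real.cos (InnerProductGeometry.angle (x - x₀) (y₀ - x₀)) :=
    Real.cos_le_cos_of_nonneg_of_le_pi (InnerProductGeometry.angle_nonneg _ _)
      (by linarith [Real.pi_pos]) hxβ.le
  have h2 := InnerProductGeometry.cos_angle_mul_norm_mul_norm (x - x₀) (y₀ - x₀)
  rw [hRn] at h2
  have h3 : Real.cos β * (‖x - x₀‖ * R) ≤ inner ℝ (x - x₀) (y₀ - x₀) := by
    rw [← h2]; gcongr
  have h4 : ‖x - (x₀ + v)‖ ^ 2 = ‖x - x₀‖ ^ 2 - 2 * (ρ / R * inner ℝ (x - x₀) (y₀ - x₀)) +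
      ρ ^ 2 := by
    rw [← sub_sub, norm_sub_sq_real, hvn, hv, inner_smul_right]
  have h5 : ρ * Real.cos β * ‖x - x₀‖ ≤ ρ / R * inner ℝ (x - x₀) (y₀ - x₀) := by
    calc ρ * Real.cos β * ‖x - x₀‖ = ρ / R * (Real.cos β * (‖x - x₀‖ * R)) := by field_simp
      _ ≤ _ := by gcongr
  -- `|x - x₀| < ρ cos β` absorbs the quadratic term `|x - x₀|²`.
  have h6 : ρ * Real.cos β * ‖x - x₀‖ ≤ ρ ^ 2 - ‖x - (x₀ + v)‖ ^ 2 := by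
    rw [h4]; nlinarith
  have hpos : 0 < ρ * Real.cos β * ‖x - x₀‖ := by positivity
  have hxb : x ∈ ball (x₀ + v) ρ := by
    rw [mem_ball, dist_eq_norm]
    exact lt_of_pow_lt_pow_left₀ 2 hρ.le (by linarith)
  rw [EReal.coe_le_coe_iff, le_div_iff₀ (by positivity), ← Real.mul_rpow (by positivity) ht.le]
  refine le_trans ?_ (hb ρ hρ hρ'.1 _ hsub hmem x hxb)
  exact Real.rpow_le_rpow hpos.le (le_max_of_le_left h6) hs.le

end FracHopf

end

theorem mainTheorem3 {N : ℕ} (hN : 1 ≤ N) {s : ℝ} (hs0 : 0 < s) (hs1 : s < 1)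
    (Ω : Set (EuclideanSpace ℝ (Fin N))) (hΩ : IsOpen Ω)
    (c : EuclideanSpace ℝ (Fin N) → ℝ) (hc : MemLp c ⊤ (volume.restrict Ω))
    (u : EuclideanSpace ℝ (Fin N) → ℝ) (hu_cont : Continuous u)
    (hu : FracHopf.IsSupersolution s Ω c u)
    (hu_neg : MemLp (fun x => max (-u x) 0) ⊤ (volume.restrict Ω))
    (x₀ : EuclideanSpace ℝ (Fin N)) (hx₀ : x₀ ∈ frontier Ω)
    (y₀ : EuclideanSpace ℝ (Fin N)) (R : ℝ) (hR : 0 < R)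
    (hball : ball y₀ R ⊆ Ω) (hx₀y₀ : x₀ ∈ sphere y₀ R)
    (δ : ℝ) (hδ : 0 < δ) (hu_nonneg : ∀ x ∈ ball x₀ δ ∩ Ω, 0 ≤ u x)
    (z : ℝ → EuclideanSpace ℝ (Fin N))
    (hz : ∀ᶠ r in 𝓝[>] (0 : ℝ), ball (z r) r ⊆ Ω ∧ x₀ ∈ sphere (z r) r) :
    FracHopf.FastGrowth s z u ↔ FracHopf.SatisfiesHopf s Ω x₀ y₀ u := by
  have hx₀Ω : x₀ ∉ Ω := by
    rw [hΩ.frontier_eq] at hx₀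
    exact hx₀.2
  have hux₀ : u x₀ = 0 := hu.2.1 x₀ hx₀Ω
  have hu0 : ∀ x ∈ ball x₀ δ, 0 ≤ u x := fun x hx => by
    by_cases h : x ∈ Ω
    · exact hu_nonneg x ⟨hx, h⟩
    · exact (hu.2.1 x h).ge
  constructor
  · intro hF
    obtain ⟨ρ₀, hρ₀, hb⟩ := FracHopf.barrier_le_of_infinite_interaction hN hs0 hs1 hΩ hc hu_cont hu
      hu_neg hδ hu0 (FracHopf.interaction_eq_top_of_fastGrowth hN hs0 hδ hux₀ hu0 hz hF)
    exact FracHopf.satisfiesHopf_of_barrier_le hs0 hx₀Ω hR hball hx₀y₀ hρ₀ hb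
  · intro hH
    obtain ⟨ρ₀, hρ₀, hb⟩ := FracHopf.barrier_le_of_infinite_interaction hN hs0 hs1 hΩ hc hu_cont hu
      hu_neg hδ hu0 (FracHopf.interaction_eq_top_of_satisfiesHopf hN hs0 hδ hux₀ hR hball hx₀y₀ hH)
    exact FracHopf.fastGrowth_of_barrier_le hs0 hρ₀ hb hz
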